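/- Commutators are $[a,b]=a^{-1}b^{-1}ab$, and longer ones are left-normed: $[a_1,a_2,\dots,a_r]=[\dots[[a_1,a_2],a_3],\dots,a_r]$. For a finite group $G$, an integer $n\ge 1$ and an element $g\in G$ put $E_n(g)=\langle [x,\underbrace{g,\dots,g}_{n}]\mid x\in G\rangle$. For an automorphism $\alpha$ of $G$ put $[G,\alpha]=\langle [x,\alpha]\mid x\in G\rangle$ and $E_{G,n}(\alpha)=\langle [x,\underbrace{\alpha,\dots,\alpha}_{n}]\mid x\in G\rangle$, the commutators being taken in the semidirect product $G\langle\alpha\rangle$, so that $[x,\alpha]=x^{-1}x^{\alpha}$. The generalized Fitting subgroup $F^*(G)$ is the product of the Fitting subgroup $F(G)$ and all subnormal quasisimple subgroups of $G$ (a group $Q$ is quasisimple if $Q=[Q,Q]$ and $Q/Z(Q)$ is a nonabelian simple group). Let $F^*_0(G)=1$, let $F^*_{i+1}(G)$ be the inverse image of $F^*(G/F^*_i(G))$ in $G$, and let the generalized Fitting height $h^*(G)$ be the least $h$ with $F^*_h(G)=G$. The nonsoluble length $\lambda(G)$ is the minimum number of nonsoluble factors in a normal series of $G$ each of whose factors is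 either soluble or a direct product of nonabelian simple groups, and $R_i(G)$ is the largest normal subgroup of $G$ of nonsoluble length at most $i$. **Theorem.** Let $n$ be a positive integer. Assume that $E_{S,n}(\varphi)=S$ for every direct product $S=S_1\times\dots\times S_r$ of finitely many nonabelian finite simple groups and every nontrivial automorphism $\varphi$ of $S$ that transitively permutes the factors $S_1,\dots,S_r$. Then for every finite group $G$: 1. for every $g\in G$, if $h^*(E_n(g))=k$, then $g\in F^*_{k+1}(G)$; 2. for every $g\in G$, if $\lambda(E_n(g))=k$, then $g\in R_k(G)$; 3. for every automorphism $\alpha$ of $G$, if $G=[G,\alpha]$, then $E_{G,n}(\alpha)=G$. -/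

import Mathlib

universe u

namespace EngelSink

/-- A nonabelian simple group. -/
def IsNonabelianSimple (G : Type u) [Group G] : Prop :=
  IsSimpleGroup G ∧ ∃ a b : G, a * b ≠ b * a

/-! ### Engel commutators and the subgroups they generate

Commutators are `[a, b] = a⁻¹ b⁻¹ a b`, left-normed. For an automorphism `φ` of `G` the commutator
`[x, φ]` in the semidirect product of `G` and `⟨φ⟩`, where `φ⁻¹ x φ` is the image of `x` under `φ`,
is `x⁻¹ φ(x)`. -/

/-- `[x, g, …, g]` with `g` repeated `n` times. -/
def engelComm {G : Type u} [Group G] (g : G) (n : ℕ) (x : G) : G :=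
  (fun y : G => y⁻¹ * g⁻¹ * y * g)^[n] x

/-- `E_n(g)`, the subgroup generated by all `[x, g, …, g]` (`g` repeated `n` times), `x ∈ G`. -/
def engelSubgroup {G : Type u} [Group G] (g : G) (n : ℕ) : Subgroup G :=
  Subgroup.closure (Set.range (engelComm g n))

/-- `[x, φ, …, φ]` with the automorphism `φ` repeated `n` times. -/
def autEngelComm {G : Type u} [Group G] (φ : MulAut G) (n : ℕ) (x : G) : G :=
  (fun y : G => y⁻¹ * φ y)^[n] x

/-- `E_{G,n}(φ)`, the subgroup generated by all `[x, φ, …, φ]` (`φ` repeated `n` times), `x ∈ G`. -/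
def autEngelSubgroup {G : Type u} [Group G] (φ : MulAut G) (n : ℕ) : Subgroup G :=
  Subgroup.closure (Set.range (autEngelComm φ n))

/-- `[G, φ]`, the subgroup generated by all `[x, φ]`, `x ∈ G`. -/
def autCommutator {G : Type u} [Group G] (φ : MulAut G) : Subgroup G :=
  Subgroup.closure (Set.range fun x : G => x⁻¹ * φ x)

/-- The automorphism `φ` of the direct product of the groups `T i` transitively permutes the
factors: there is a transitive permutation `σ` of the indices such that `φ` maps the `i`-th factor
onto the `σ i`-th one. -/
def PermutesFactorsTransitively {r : ℕ} (T : Fin r → Type u) [∀ i, Group (T i)]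
    (φ : MulAut (∀ i, T i)) : Prop :=
  ∃ σ : Equiv.Perm (Fin r),
    (∀ i, (MonoidHom.mulSingle T i).range.map φ.toMonoidHom = (MonoidHom.mulSingle T (σ i)).range) ∧
      ∀ i j, σ.SameCycle i j

/-- `E_{S,n}(φ) = S` for every direct product `S` of finitely many nonabelian finite simple groups
and every nontrivial automorphism `φ` of `S` that transitively permutes the factors. (For a single
factor the identity permutes the factors transitively, but `E_{S,n}(1) = 1`.) -/
def EngelGeneratesSimpleProducts (n : ℕ) : Prop :=
  ∀ (r : ℕ) (T : Fin r → Type u) [∀ i, Group (T i)] [∀ i, Finite (T i)],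
    (∀ i, IsNonabelianSimple (T i)) →
      ∀ φ : MulAut (∀ i, T i), φ ≠ 1 → PermutesFactorsTransitively T φ →
        autEngelSubgroup φ n = ⊤

/-! ### The generalized Fitting series and height -/

/-- A group is quasisimple if it is equal to its derived subgroup and its quotient by the centre is
a nonabelian simple group. -/
def IsQuasisimple (Q : Type u) [Group Q] : Prop :=
  commutator Q = ⊤ ∧ IsNonabelianSimple (Q ⧸ Subgroup.center Q)

/-- The Fitting subgroup `F(G)`, generated by all nilpotent normal subgroups; for finite `G` it is
the largest nilpotent normal subgroup. -/
def fitting (G : Type u) [Group G] : Subgroup G :=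
  sSup {N : Subgroup G | N.Normal ∧ Group.IsNilpotent N}

/-- The generalized Fitting subgroup `F^*(G)`, the product of the Fitting subgroup and all
subnormal quasisimple subgroups. -/
def genFitting (G : Type u) [Group G] : Subgroup G :=
  fitting G ⊔ sSup {Q : Subgroup G | Q.IsSubnormal ∧ IsQuasisimple Q}

theorem IsNonabelianSimple.of_equiv {G H : Type u} [Group G] [Group H] (e : G ≃* H)
    (h : IsNonabelianSimple G) : IsNonabelianSimple H := by
  obtain ⟨hs, a, b, hab⟩ := h
  refine ⟨(MulEquiv.isSimpleGroup_congr e).1 hs, e a, e b, fun hc => hab ?_⟩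
  apply e.injective
  simpa using hc

theorem IsQuasisimple.of_equiv {G H : Type u} [Group G] [Group H] (e : G ≃* H)
    (h : IsQuasisimple G) : IsQuasisimple H := by
  refine ⟨?_, ?_⟩
  · have h1 := Subgroup.map_commutator (⊤ : Subgroup G) ⊤ e.toMonoidHom
    have h2 : (⊤ : Subgroup G).map e.toMonoidHom = ⊤ :=
      Subgroup.map_top_of_surjective _ e.surjective
    have h3 : ⁅(⊤ : Subgroup G), ⊤⁆ = ⊤ := h.1
    rw [h3, h2] at h1
    exact h1.symm
  · refine IsNonabelianSimple.of_equiv (QuotientGroup.congr _ _ e ?_) h.2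
    ext x
    simp only [Subgroup.mem_map, Subgroup.mem_center_iff]
    constructor
    · rintro ⟨y, hy, rfl⟩ z
      have := congrArg e (hy (e.symm z))
      simpa using this
    · intro hx
      refine ⟨e.symm x, fun z => ?_, by simp⟩
      apply e.injective
      simpa using hx (e z)

theorem sSup_normal_of_conj {G : Type u} [Group G] (A : Set (Subgroup G))
    (hA : ∀ Q ∈ A, ∀ g : G, Q.map (MulAut.conj g).toMonoidHom ∈ A) : (sSup A).Normal := by
  refine ⟨fun x hx g => ?_⟩
  have h : (sSup A).map (MulAut.conj g).toMonoidHom ≤ sSup A := by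
    rw [Subgroup.map_le_iff_le_comap]
    refine sSup_le fun Q hQ => ?_
    rw [← Subgroup.map_le_iff_le_comap]
    exact le_sSup (hA Q hQ g)
  exact h ⟨x, hx, rfl⟩

theorem genFitting_normal (G : Type u) [Group G] : (genFitting G).Normal := by
  have h1 : (fitting G).Normal := by
    refine sSup_normal_of_conj _ fun N hN g => ?_
    have := hN.1
    rwa [show N.map (MulAut.conj g).toMonoidHom = N from Subgroup.Normal.map_conj_eq ..]
  have h2 : (sSup {Q : Subgroup G | Q.IsSubnormal ∧ IsQuasisimple Q}).Normal := by
    refine sSup_normal_of_conj _ fun Q hQ g => ?_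
    exact ⟨hQ.1.map (MulAut.conj g).surjective,
      hQ.2.of_equiv (Q.equivMapOfInjective _ (MulAut.conj g).injective)⟩
  exact Subgroup.sup_normal _ _

/-- The generalized Fitting series, each term with a proof of its normality: it starts from `1`,
and each next term is the inverse image of `F^*` of the quotient by the previous one. -/
def genFittingSeriesAux (G : Type u) [Group G] : ℕ → {N : Subgroup G // N.Normal}
  | 0 => ⟨⊥, inferInstance⟩
  | i + 1 =>
    let N := genFittingSeriesAux G i
    haveI : N.1.Normal := N.2
    haveI : (genFitting (G ⧸ N.1)).Normal := genFitting_normal _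
    ⟨(genFitting (G ⧸ N.1)).comap (QuotientGroup.mk' N.1), inferInstance⟩

/-- The `i`-th term `F^*_i(G)` of the generalized Fitting series. -/
def genFittingSeries (G : Type u) [Group G] (i : ℕ) : Subgroup G :=
  (genFittingSeriesAux G i).1

/-- The generalized Fitting height `h^*(G)`, the least `h` with `F^*_h(G) = G`. -/
noncomputable def genFittingHeight (G : Type u) [Group G] : ℕ :=
  sInf {h : ℕ | genFittingSeries G h = ⊤}

/-! ### Nonsoluble length -/

/-- A direct product of finitely many nonabelian simple groups. -/
def IsProductOfNonabelianSimple (G : Type u) [Group G] : Prop :=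
  ∃ (r : ℕ) (T : Fin r → Type u) (_ : ∀ i, Group (T i)),
    (∀ i, IsNonabelianSimple (T i)) ∧ Nonempty (G ≃* ∀ i, T i)

/-- A normal series `1 = N_0 ≤ N_1 ≤ … ≤ N_l = G` of normal subgroups of `G`, each of whose
factors is soluble or a direct product of nonabelian simple groups. -/
structure SolubleSimpleSeries (G : Type u) [Group G] where
  /-- The length of the series. -/
  length : ℕ
  /-- The terms of the series; only those with index at most `length` matter. -/
  term : ℕ → Subgroup G
  normal : ∀ i, (term i).Normal
  mono : ∀ i < length, term i ≤ term (i + 1)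
  term_zero : term 0 = ⊥
  term_length : term length = ⊤
  factor : ∀ i < length,
    Group.IsSolvable (term (i + 1) ⧸ (term i).subgroupOf (term (i + 1))) ∨
      IsProductOfNonabelianSimple (term (i + 1) ⧸ (term i).subgroupOf (term (i + 1)))

open Classical in
/-- The number of nonsoluble factors of the series. -/
noncomputable def SolubleSimpleSeries.numNonsoluble {G : Type u} [Group G]
    (s : SolubleSimpleSeries G) : ℕ :=
  haveI := s.normal
  ((Finset.range s.length).filter fun i =>
    ¬ Group.IsSolvable (s.term (i + 1) ⧸ (s.term i).subgroupOf (s.term (i + 1)))).card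

/-- The nonsoluble length `λ(G)`, the minimum number of nonsoluble factors in a normal series each
of whose factors is soluble or a direct product of nonabelian simple groups. -/
noncomputable def nonsolubleLength (G : Type u) [Group G] : ℕ :=
  sInf (Set.range fun s : SolubleSimpleSeries G => s.numNonsoluble)

/-- The term `R_i(G)` of the upper nonsoluble series: the largest normal subgroup of `G` of
nonsoluble length at most `i`. -/
def nonsolubleRadical (G : Type u) [Group G] (i : ℕ) : Subgroup G :=
  sSup {N : Subgroup G | N.Normal ∧ nonsolubleLength N ≤ i}

end EngelSink

open EngelSink

/-!
The third part is proved by induction on `|G|`. Let `E = E_{G,n}(α)`. By induction `E M = G` for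
every nontrivial normal `α`-invariant subgroup `M`, and since the fixed points of `α` normalize `E`
and `G = [G, α]`, it suffices to generate `G` by `E` and fixed points. If `F(G) = 1`, take
`M = F^*(G)`: it is a direct product of simple groups permuted by `α`, and by the hypothesis each
orbit of factors consists of fixed points or lies in `E`. Otherwise take `M` minimal among the
nontrivial normal `α`-invariant subgroups of `G` contained in `Z(F(G))`. Then `E ∩ M` is normal in
`G = E M`, because `M` is abelian; if it is trivial, then the fixed points of `α` in `M` are central
in `G`, so either `M` is fixed pointwise, or `x ↦ [x, α]` is a bijection of `M` and `M ≤ E`.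

For the first two parts, the series `G ≥ [G, g] ≥ [G, g, g] ≥ …` of subnormal subgroups stabilizes
at some `K = [K, g]`, and `K ≤ E_n(g)` by the third part. Both `h^* ≤ k` and `λ ≤ k` define classes
closed under quotients, subnormal subgroups and products of normal subgroups, so `K` lies in the
radical `R` of `G` for such a class as soon as `E_n(g)` belongs to it. Modulo `R` some
`[G, g, …, g]` is trivial, which makes `⟨g⟩` subnormal and puts `g` into `F(G/R)`. This is contained
in `F^*(G/R) = F^*_{k+1}(G)/F^*_k(G)` for `h^*`, and is trivial for `λ`.
-/

namespace EngelSink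

open scoped commutatorElement

/-! ### Fitting formations and their radicals -/

/-- A class of groups, given by its membership predicate. -/
abbrev GroupClass := ∀ (G : Type u) [Group G], Prop

/-- A class of groups whose finite members are closed under homomorphic images, normal subgroups
and products of normal subgroups. Isomorphism invariance is a special case of the first. -/
structure IsFittingFormation (C : GroupClass.{u}) : Prop where
  of_subsingleton : ∀ (G : Type u) [Group G] [Subsingleton G], C G
  of_surjective : ∀ {G H : Type u} [Group G] [Group H] [Finite G] (f : G →* H),
    Function.Surjective f → C G → C H
  of_normal : ∀ {G : Type u} [Group G] [Finite G] (N : Subgroup G) [N.Normal], C G → C N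
  of_sup_eq_top : ∀ {G : Type u} [Group G] [Finite G] (M N : Subgroup G) [M.Normal] [N.Normal],
    C M → C N → M ⊔ N = ⊤ → C G

/-- The `C`-radical of a group, generated by all normal `C`-subgroups. -/
def radical (C : GroupClass.{u}) (G : Type u) [Group G] : Subgroup G :=
  sSup {N : Subgroup G | N.Normal ∧ C N}

/-- The class of extensions of `C`-groups by `D`-groups: the normal subgroup is in `C`, the quotient
is in `D`. -/
def ExtensionClass (C D : GroupClass.{u}) : GroupClass.{u} := fun G _ =>
  ∃ (N : Subgroup G) (_ : N.Normal), C N ∧ D (G ⧸ N)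

section Radical

variable {C : GroupClass.{u}} {G : Type u} [Group G]

instance radical_normal : (radical C G).Normal :=
  Subgroup.sSup_normal _ fun _ h => h.1

theorem le_radical (N : Subgroup G) [hN : N.Normal] (h : C N) : N ≤ radical C G :=
  le_sSup ⟨hN, h⟩

end Radical

section Quotient

variable {G : Type u} [Group G] (N : Subgroup G) [N.Normal]

/-- The second isomorphism theorem, with the group `M N / N` as an image in `G ⧸ N`. -/
noncomputable def quotientSubgroupOfEquivMap (M : Subgroup G) :
    M ⧸ N.subgroupOf M ≃* M.map (QuotientGroup.mk' N) :=
  (QuotientGroup.quotientMulEquivOfEq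
    (by rw [Subgroup.ker_subgroupMap, QuotientGroup.ker_mk'])).trans
    (QuotientGroup.quotientKerEquivOfSurjective _
      ((QuotientGroup.mk' N).subgroupMap_surjective M))

/-- The third isomorphism theorem, for a subgroup given in the quotient. -/
def quotientQuotientEquivQuotientComap (K : Subgroup (G ⧸ N)) [K.Normal] :
    (G ⧸ N) ⧸ K ≃* G ⧸ K.comap (QuotientGroup.mk' N) :=
  (QuotientGroup.quotientMulEquivOfEq (Subgroup.map_comap_eq_self_of_surjective
    (QuotientGroup.mk'_surjective N) K).symm).trans
    (QuotientGroup.quotientQuotientEquivQuotient N _ (QuotientGroup.le_comap_mk' N K))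

/-- Both sides are copies of `M ⊓ N`. -/
def subgroupOfEquivSubgroupOf (M N : Subgroup G) : M.subgroupOf N ≃* N.subgroupOf M :=
  (MulEquiv.subgroupCongr (Subgroup.inf_subgroupOf_right M N).symm).trans <|
    (Subgroup.subgroupOfEquivOfLe inf_le_right).trans <|
      (Subgroup.subgroupOfEquivOfLe inf_le_left).symm.trans <|
        MulEquiv.subgroupCongr (Subgroup.inf_subgroupOf_left N M)

end Quotient

namespace IsFittingFormation

variable {C D : GroupClass.{u}} {G H : Type u} [Group G] [Group H] [Finite G]

theorem of_mulEquiv (hC : IsFittingFormation C) (e : G ≃* H) (h : C G) : C H :=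
  hC.of_surjective e.toMonoidHom e.surjective h

theorem map (hC : IsFittingFormation C) (f : G →* H) (N : Subgroup G) (h : C N) :
    C (N.map f) :=
  hC.of_surjective (f.subgroupMap N) (f.subgroupMap_surjective N) h

theorem subgroupOf (hC : IsFittingFormation C) {N M : Subgroup G} (hle : N ≤ M) (h : C N) :
    C (N.subgroupOf M) :=
  hC.of_mulEquiv (Subgroup.subgroupOfEquivOfLe hle).symm h

theorem sup (hC : IsFittingFormation C) (M N : Subgroup G) [M.Normal] [N.Normal]
    (hM : C M) (hN : C N) : C ↥(M ⊔ N) := by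
  refine hC.of_sup_eq_top (M.subgroupOf (M ⊔ N)) (N.subgroupOf (M ⊔ N))
    (hC.subgroupOf le_sup_left hM) (hC.subgroupOf le_sup_right hN) ?_
  rw [← Subgroup.subgroupOf_sup le_sup_left le_sup_right, Subgroup.subgroupOf_self]

theorem radical_mem (hC : IsFittingFormation C) : C (radical C G) := by
  obtain ⟨N, hN⟩ := (Set.toFinite {N : Subgroup G | N.Normal ∧ C N}).exists_maximal
    ⟨⊥, inferInstance, hC.of_subsingleton _⟩
  have := hN.prop.1
  suffices h : radical C G = N from h ▸ hN.prop.2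
  refine le_antisymm (sSup_le fun M hM => ?_) (le_radical N hN.prop.2)
  have := hM.1
  exact le_sup_right.trans
    (hN.le_of_ge ⟨Subgroup.sup_normal N M, hC.sup N M hN.prop.2 hM.2⟩ le_sup_left)

theorem radical_eq_top_iff (hC : IsFittingFormation C) : radical C G = ⊤ ↔ C G := by
  refine ⟨fun h => hC.of_mulEquiv Subgroup.topEquiv ?_, fun h =>
    top_le_iff.1 (le_radical ⊤ (hC.of_mulEquiv Subgroup.topEquiv.symm h))⟩
  exact h ▸ hC.radical_mem

theorem map_radical_le (hC : IsFittingFormation C) (f : G →* H) (hf : Function.Surjective f) :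
    (radical C G).map f ≤ radical C H :=
  have := radical_normal (C := C) (G := G).map f hf
  le_radical _ (hC.map f _ hC.radical_mem)

theorem radical_characteristic (hC : IsFittingFormation C) : (radical C G).Characteristic :=
  Subgroup.characteristic_iff_map_le.2 fun e => hC.map_radical_le e.toMonoidHom e.surjective

theorem map_radical_subtype_le (hC : IsFittingFormation C) (N : Subgroup G) [N.Normal] :
    (radical C N).map N.subtype ≤ radical C G :=
  have := hC.radical_characteristic (G := N)
  le_radical _ (hC.map _ _ hC.radical_mem)

theorem le_radical_of_isSubnormal (hC : IsFittingFormation C) {K : Subgroup G}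
    (hK : K.IsSubnormal) (h : C K) : K ≤ radical C G := by
  suffices key : (radical C K).map K.subtype ≤ radical C G by
    simpa [hC.radical_eq_top_iff.2 h, ← MonoidHom.range_eq_map] using key
  clear h
  induction hK with
  | top =>
    exact hC.map_radical_le (Subgroup.topEquiv (G := G)).toMonoidHom
      Subgroup.topEquiv.surjective
  | step K L hle _ hn ih =>
    let e := Subgroup.subgroupOfEquivOfLe hle
    have hKL : (radical C K).map e.symm.toMonoidHom ≤ radical C (K.subgroupOf L) :=
      hC.map_radical_le _ e.symm.surjective
    calc (radical C K).map K.subtype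
        = (((radical C K).map e.symm.toMonoidHom).map (K.subgroupOf L).subtype).map L.subtype := by
          simp only [Subgroup.map_map]; rfl
      _ ≤ (radical C L).map L.subtype :=
          Subgroup.map_mono ((Subgroup.map_mono hKL).trans (hC.map_radical_subtype_le _))
      _ ≤ radical C G := ih

theorem of_isSubnormal (hC : IsFittingFormation C) {K : Subgroup G}
    (hK : K.IsSubnormal) (h : C G) : C K := by
  induction hK with
  | top => exact hC.of_mulEquiv Subgroup.topEquiv.symm h
  | step K L hle _ hn ih =>
    exact hC.of_mulEquiv (Subgroup.subgroupOfEquivOfLe hle) (hC.of_normal (K.subgroupOf L) ih)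

theorem quotient_of_le (hD : IsFittingFormation D) {M N : Subgroup G} [M.Normal] [N.Normal]
    (hle : M ≤ N) (h : D (G ⧸ M)) : D (G ⧸ N) :=
  hD.of_mulEquiv (QuotientGroup.quotientQuotientEquivQuotient M N hle)
    (hD.of_surjective (QuotientGroup.mk' _) (QuotientGroup.mk'_surjective _) h)

theorem extensionClass_iff (hC : IsFittingFormation C) (hD : IsFittingFormation D) :
    ExtensionClass C D G ↔ D (G ⧸ radical C G) :=
  ⟨fun ⟨N, _, hN, hQ⟩ => hD.quotient_of_le (le_radical N hN) hQ,
    fun h => ⟨radical C G, inferInstance, hC.radical_mem, h⟩⟩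

theorem extensionClass_of_surjective (hC : IsFittingFormation C) (hD : IsFittingFormation D)
    (f : G →* H) (hf : Function.Surjective f) (h : ExtensionClass C D G) :
    ExtensionClass C D H := by
  obtain ⟨N, hN, hCN, hDN⟩ := h
  refine ⟨N.map f, hN.map f hf, hC.map f N hCN, ?_⟩
  have := hN.map f hf
  exact hD.of_surjective (QuotientGroup.map N (N.map f) f (Subgroup.le_comap_map f N))
    (QuotientGroup.map_surjective_of_surjective _ _ _
      ((QuotientGroup.mk'_surjective _).comp hf) _) hDN

theorem extensionClass_of_normal (hC : IsFittingFormation C) (hD : IsFittingFormation D)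
    (M : Subgroup G) [hM : M.Normal] (h : ExtensionClass C D G) : ExtensionClass C D M := by
  obtain ⟨N, _, hCN, hDN⟩ := h
  have := hM.map _ (QuotientGroup.mk'_surjective N)
  exact ⟨N.subgroupOf M, inferInstance,
    hC.of_mulEquiv (subgroupOfEquivSubgroupOf M N) (hC.of_normal _ hCN),
    hD.of_mulEquiv (quotientSubgroupOfEquivMap N M).symm (hD.of_normal _ hDN)⟩

theorem map_mk_radical_mem (hC : IsFittingFormation C) (hD : IsFittingFormation D)
    (M : Subgroup G) [M.Normal] (h : ExtensionClass C D M) :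
    D (M.map (QuotientGroup.mk' (radical C G))) := by
  rw [hC.extensionClass_iff hD] at h
  refine hD.of_mulEquiv (quotientSubgroupOfEquivMap _ M) (hD.quotient_of_le ?_ h)
  exact Subgroup.map_le_iff_le_comap.1 (hC.map_radical_subtype_le M)

theorem extensionClass (hC : IsFittingFormation C) (hD : IsFittingFormation D) :
    IsFittingFormation (ExtensionClass C D) where
  of_subsingleton G _ _ := ⟨⊥, inferInstance, hC.of_subsingleton _,
    have := (QuotientGroup.mk'_surjective (⊥ : Subgroup G)).subsingleton
    hD.of_subsingleton _⟩
  of_surjective := hC.extensionClass_of_surjective hD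
  of_normal N _ := hC.extensionClass_of_normal hD N
  of_sup_eq_top {G _ _} M N hM hN hCM hCN h := by
    have hmk := QuotientGroup.mk'_surjective (radical C G)
    have := hM.map _ hmk
    have := hN.map _ hmk
    rw [hC.extensionClass_iff hD]
    refine hD.of_sup_eq_top _ _ (hC.map_mk_radical_mem hD M hCM) (hC.map_mk_radical_mem hD N hCN) ?_
    rw [← Subgroup.map_sup, h, Subgroup.map_top_of_surjective _ hmk]

theorem radical_extensionClass (hC : IsFittingFormation C) (hD : IsFittingFormation D) :
    radical (ExtensionClass C D) G =
      (radical D (G ⧸ radical C G)).comap (QuotientGroup.mk' (radical C G)) := by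
  have hmk := QuotientGroup.mk'_surjective (radical C G)
  refine le_antisymm (sSup_le fun N ⟨hN, hCN⟩ => ?_) (le_radical _ ?_)
  · have := hN.map _ hmk
    exact Subgroup.map_le_iff_le_comap.1 (le_radical _ (hC.map_mk_radical_mem hD N hCN))
  · refine ⟨_, inferInstance, hC.subgroupOf (QuotientGroup.le_comap_mk' _ _) hC.radical_mem,
      hD.of_mulEquiv (quotientSubgroupOfEquivMap _ _).symm ?_⟩
    rw [Subgroup.map_comap_eq_self_of_surjective hmk]
    exact hD.radical_mem

theorem extensionClass_assoc {B : GroupClass.{u}} (hB : IsFittingFormation B)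
    (hC : IsFittingFormation C) (hD : IsFittingFormation D) :
    ExtensionClass (ExtensionClass B C) D G ↔ ExtensionClass B (ExtensionClass C D) G := by
  have e := (quotientQuotientEquivQuotientComap (radical B G) (radical C (G ⧸ radical B G))).trans
    (QuotientGroup.quotientMulEquivOfEq (hB.radical_extensionClass hC).symm)
  rw [(hB.extensionClass hC).extensionClass_iff hD, hB.extensionClass_iff (hC.extensionClass hD),
    hC.extensionClass_iff hD]
  exact ⟨hD.of_mulEquiv e.symm, hD.of_mulEquiv e⟩

end IsFittingFormation

section IterExtension

/-- The iterated extensions `(D 0)`-by-`(D 1)`-by-…-by-`(D (j - 1))`. -/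
def iterExtension (D : ℕ → GroupClass.{u}) : ℕ → GroupClass.{u}
  | 0 => fun G _ => Subsingleton G
  | j + 1 => ExtensionClass (iterExtension D j) (D j)

theorem isFittingFormation_subsingleton :
    IsFittingFormation (fun (G : Type u) _ => Subsingleton G) where
  of_subsingleton _ _ h := h
  of_surjective _ hf h := hf.subsingleton
  of_normal _ _ h := inferInstance
  of_sup_eq_top M N _ _ hM hN h := by
    rw [Subgroup.eq_bot_of_subsingleton M, Subgroup.eq_bot_of_subsingleton N, sup_idem] at h
    exact (Subgroup.subsingleton_iff).1 (subsingleton_of_bot_eq_top h)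

variable {D : ℕ → GroupClass.{u}}

theorem isFittingFormation_iterExtension (hD : ∀ j, IsFittingFormation (D j)) :
    ∀ j, IsFittingFormation (iterExtension D j)
  | 0 => isFittingFormation_subsingleton
  | j + 1 => (isFittingFormation_iterExtension hD j).extensionClass (hD j)

variable (G : Type u) [Group G]

theorem radical_iterExtension_zero : radical (iterExtension D 0) G = ⊥ :=
  eq_bot_iff.2 (sSup_le fun N ⟨_, (_ : Subsingleton N)⟩ => (Subgroup.eq_bot_of_subsingleton N).le)

variable [Finite G]

theorem radical_iterExtension_le_succ (hD : ∀ j, IsFittingFormation (D j)) (j : ℕ) :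
    radical (iterExtension D j) G ≤ radical (iterExtension D (j + 1)) G := by
  rw [iterExtension, (isFittingFormation_iterExtension hD j).radical_extensionClass (hD j)]
  exact QuotientGroup.le_comap_mk' _ _

end IterExtension

/-! ### Nilpotent and soluble groups -/

section Nilpotent

variable {G : Type u} [Group G]

theorem inf_center_ne_bot_of_isNilpotent [Group.IsNilpotent G] (A : Subgroup G) [hA : A.Normal]
    (hne : A ≠ ⊥) : A ⊓ Subgroup.center G ≠ ⊥ := by
  refine fun hbot => hne ?_
  have hinf : ∀ i, A ⊓ Subgroup.upperCentralSeries G i = ⊥ := by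
    intro i
    induction i with
    | zero => rw [Subgroup.upperCentralSeries_zero, inf_bot_eq]
    | succ i ih =>
      refine le_bot_iff.1 (hbot ▸ fun x hx => ⟨hx.1, Subgroup.mem_center_iff.2 fun g => ?_⟩)
      have hcomm : x * g * x⁻¹ * g⁻¹ ∈ A ⊓ Subgroup.upperCentralSeries G i :=
        ⟨Subgroup.commutator_le_left A ⊤ (Subgroup.commutator_mem_commutator hx.1 trivial),
          Subgroup.mem_upperCentralSeries_succ_iff.1 hx.2 g⟩
      rw [ih, Subgroup.mem_bot, mul_inv_eq_one, mul_inv_eq_iff_eq_mul] at hcomm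
      exact hcomm.symm
  obtain ⟨c, hc⟩ := Group.IsNilpotent.nilpotent G
  simpa only [hc, inf_top_eq] using hinf c

theorem inf_centralizer_ne_bot (A N : Subgroup G) [hA : A.Normal] [hN : N.Normal]
    [Group.IsNilpotent N] (hne : A ≠ ⊥) : A ⊓ Subgroup.centralizer (N : Set G) ≠ ⊥ := by
  by_cases hd : Disjoint A N
  · rwa [inf_eq_left.2 fun a ha n hn => (Subgroup.commute_of_normal_of_disjoint A N hA hN hd a n
      ha hn).symm]
  · obtain ⟨⟨x, hxA, hxZ⟩, hx⟩ := Subgroup.ne_bot_iff_exists_ne_one.1 <|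
      inf_center_ne_bot_of_isNilpotent (A.subgroupOf N) (by rwa [Ne, Subgroup.subgroupOf_eq_bot])
    refine fun hbot => hx (Subtype.ext (Subtype.ext (Subgroup.mem_bot.1 (hbot ▸ ?_))))
    exact ⟨hxA, fun n hn => congrArg Subtype.val (Subgroup.mem_center_iff.1 hxZ ⟨n, hn⟩)⟩

theorem inf_centralizer_le_center (M N : Subgroup G) (h : M ⊔ N = ⊤) :
    Subgroup.centralizer (M : Set G) ⊓ Subgroup.centralizer (N : Set G) ≤ Subgroup.center G := by
  rw [← Subgroup.centralizer_univ, ← Subgroup.coe_top, ← h, Subgroup.le_centralizer_iff]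
  exact sup_le (Subgroup.le_centralizer_iff.1 inf_le_left)
    (Subgroup.le_centralizer_iff.1 inf_le_right)

theorem center_ne_bot_of_sup_eq_top [Nontrivial G] (M N : Subgroup G) [M.Normal] [N.Normal]
    [Group.IsNilpotent M] [Group.IsNilpotent N] (h : M ⊔ N = ⊤) : Subgroup.center G ≠ ⊥ := by
  have hM := inf_centralizer_ne_bot ⊤ M top_ne_bot
  rw [top_inf_eq] at hM
  exact ne_bot_of_le_ne_bot (inf_centralizer_ne_bot _ N hM) (inf_centralizer_le_center M N h)

theorem card_quotient_lt [Finite G] {N : Subgroup G} (hN : N ≠ ⊥) :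
    Nat.card (G ⧸ N) < Nat.card G := by
  rw [Subgroup.card_eq_card_quotient_mul_card_subgroup N]
  exact lt_mul_of_one_lt_right Nat.card_pos ((Subgroup.one_lt_card_iff_ne_bot N).2 hN)

theorem isNilpotent_of_sup_eq_top [Finite G] (M N : Subgroup G) [hMn : M.Normal] [hNn : N.Normal]
    [Group.IsNilpotent M] [Group.IsNilpotent N] (h : M ⊔ N = ⊤) : Group.IsNilpotent G := by
  induction hc : Nat.card G using Nat.strong_induction_on generalizing G with
  | _ c ih =>
    cases subsingleton_or_nontrivial G
    · exact Group.isNilpotent_of_subsingleton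
    let f := QuotientGroup.mk' (Subgroup.center G)
    have hf : Function.Surjective f := QuotientGroup.mk'_surjective _
    have := hMn.map f hf
    have := hNn.map f hf
    have := Group.nilpotent_of_surjective (f.subgroupMap M) (f.subgroupMap_surjective M)
    have := Group.nilpotent_of_surjective (f.subgroupMap N) (f.subgroupMap_surjective N)
    refine Group.of_quotient_center_nilpotent
      (ih _ (hc ▸ card_quotient_lt (center_ne_bot_of_sup_eq_top M N h)) (M.map f) (N.map f) ?_ rfl)
    rw [← Subgroup.map_sup, h, Subgroup.map_top_of_surjective _ hf]

theorem surjective_mk_comp_subtype (M N : Subgroup G) [M.Normal] (h : M ⊔ N = ⊤) :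
    Function.Surjective ((QuotientGroup.mk' M).comp N.subtype) := by
  rw [← MonoidHom.range_eq_top, MonoidHom.range_comp, Subgroup.range_subtype,
    ← bot_sup_eq (N.map _), ← QuotientGroup.map_mk'_self M, ← Subgroup.map_sup, h,
    Subgroup.map_top_of_surjective _ (QuotientGroup.mk'_surjective M)]

theorem isFittingFormation_isNilpotent : IsFittingFormation.{u} Group.IsNilpotent where
  of_subsingleton _ _ _ := inferInstance
  of_surjective f hf _ := Group.nilpotent_of_surjective f hf
  of_normal _ _ _ := inferInstance
  of_sup_eq_top M N _ _ _ _ h := isNilpotent_of_sup_eq_top M N h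

theorem isFittingFormation_isSolvable : IsFittingFormation.{u} Group.IsSolvable where
  of_subsingleton _ _ _ := inferInstance
  of_surjective _ hf _ := Group.isSolvable_of_surjective hf
  of_normal _ _ _ := inferInstance
  of_sup_eq_top M N _ _ hM hN h := by
    exact (Group.isSolvable_iff_subgroup_quotient M).2
      ⟨hM, Group.isSolvable_of_surjective (surjective_mk_comp_subtype M N h)⟩

instance fitting_normal : (fitting G).Normal :=
  radical_normal (C := Group.IsNilpotent)

theorem isNilpotent_fitting [Finite G] : Group.IsNilpotent (fitting G) :=
  isFittingFormation_isNilpotent.radical_mem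

theorem le_fitting_of_isSubnormal [Finite G] {K : Subgroup G} (hK : K.IsSubnormal)
    (h : Group.IsNilpotent K) : K ≤ fitting G :=
  isFittingFormation_isNilpotent.le_radical_of_isSubnormal hK h

end Nilpotent

/-! ### Quasisimple groups and components -/

namespace IsNonabelianSimple

variable {G : Type u} [Group G]

theorem not_isSolvable (h : IsNonabelianSimple G) : ¬ Group.IsSolvable G := by
  obtain ⟨_, a, b, hab⟩ := h
  exact fun h => hab (IsSimpleGroup.comm_iff_isSolvable.2 h a b)

theorem center_eq_bot (h : IsNonabelianSimple G) : Subgroup.center G = ⊥ := by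
  obtain ⟨_, a, b, hab⟩ := h
  refine (Subgroup.Normal.eq_bot_or_eq_top inferInstance).resolve_right fun ht => hab ?_
  exact Subgroup.mem_center_iff.1 (ht.ge (Subgroup.mem_top b)) a

theorem commutator_eq_top (h : IsNonabelianSimple G) : commutator G = ⊤ := by
  obtain ⟨_, a, b, hab⟩ := h
  refine (Subgroup.Normal.eq_bot_or_eq_top inferInstance).resolve_left fun hb => hab ?_
  exact commutatorElement_eq_one_iff_mul_comm.1 <| Subgroup.mem_bot.1 <|
    hb ▸ Subgroup.commutator_mem_commutator (Subgroup.mem_top a) (Subgroup.mem_top b)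

theorem isQuasisimple (h : IsNonabelianSimple G) : IsQuasisimple G :=
  ⟨h.commutator_eq_top, h.of_equiv ((QuotientGroup.quotientMulEquivOfEq h.center_eq_bot).trans
    QuotientGroup.quotientBot).symm⟩

end IsNonabelianSimple

namespace IsQuasisimple

variable {Q H : Type u} [Group Q] [Group H]

theorem isPerfect (h : IsQuasisimple Q) : Group.IsPerfect Q :=
  ⟨h.1⟩

theorem not_isSolvable (h : IsQuasisimple Q) : ¬ Group.IsSolvable Q :=
  fun _ => h.2.not_isSolvable inferInstance

open scoped IsMulCommutative in
theorem le_center_of_normal (h : IsQuasisimple Q) (N : Subgroup Q) [hN : N.Normal] (hne : N ≠ ⊤) :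
    N ≤ Subgroup.center Q := by
  have := h.2.1
  have := h.isPerfect
  rcases (hN.map _ (QuotientGroup.mk'_surjective (Subgroup.center Q))).eq_bot_or_eq_top with hb | ht
  · rwa [Subgroup.map_eq_bot_iff, QuotientGroup.ker_mk'] at hb
  · have hsup : N ⊔ Subgroup.center Q = ⊤ := by
      rw [sup_comm, ← QuotientGroup.comap_map_mk', ht, Subgroup.comap_top]
    have hsol : Group.IsSolvable (Q ⧸ N) :=
      Group.isSolvable_of_surjective (surjective_mk_comp_subtype N _ hsup)
    have : Nontrivial (Q ⧸ N) := QuotientGroup.nontrivial_iff.2 hne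
    exact absurd hsol (Group.IsPerfect.not_isSolvable (Q ⧸ N))

theorem of_surjective (h : IsQuasisimple Q) (f : Q →* H) (hf : Function.Surjective f)
    [Nontrivial H] : IsQuasisimple H := by
  have := h.isPerfect
  have hH : Group.IsPerfect H := Group.IsPerfect.ofSurjective hf
  have hcenter : Subgroup.center Q = (Subgroup.center H).comap f := by
    refine le_antisymm (fun z hz => Subgroup.mem_center_iff.2 fun y => ?_)
      (h.le_center_of_normal _ fun ht => ?_)
    · obtain ⟨x, rfl⟩ := hf y
      rw [← map_mul, ← map_mul, Subgroup.mem_center_iff.1 hz x]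
    · refine Group.IsPerfect.not_isMulCommutative H (Subgroup.center_eq_top_iff.1 ?_)
      rw [← Subgroup.map_comap_eq_self_of_surjective hf (Subgroup.center H), ht,
        Subgroup.map_top_of_surjective f hf]
  let g : Q →* H ⧸ Subgroup.center H := (QuotientGroup.mk' _).comp f
  have hker : Subgroup.center Q = g.ker := by
    rw [hcenter, ← MonoidHom.comap_ker, QuotientGroup.ker_mk']
  exact ⟨hH.commutator_eq_top, h.2.of_equiv ((QuotientGroup.quotientMulEquivOfEq hker).trans
    (QuotientGroup.quotientKerEquivOfSurjective g ((QuotientGroup.mk'_surjective _).comp hf)))⟩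

end IsQuasisimple

section Commutator

variable {G : Type u} [Group G]

theorem commutator_eq_bot_of_isPerfect {A Q : Subgroup G} [Group.IsPerfect Q]
    (h : ⁅⁅A, Q⁆, Q⁆ = ⊥) : ⁅A, Q⁆ = ⊥ := by
  have := Subgroup.commutator_commutator_eq_bot_of_rotate (H₁ := Q) (H₂ := Q) (H₃ := A)
    (by rwa [Subgroup.commutator_comm Q A]) h
  rwa [Subgroup.commutator_eq_self, Subgroup.commutator_comm] at this

-- Climbing a subnormal chain from `K`, each step is an instance of the previous lemma.
theorem commutator_eq_bot_of_inf_isSubnormal {N K Q : Subgroup G} [N.Normal] [Group.IsPerfect Q]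
    (hK : K.IsSubnormal) (hQ : Q ≤ K) (h : ⁅N ⊓ K, Q⁆ = ⊥) : ⁅N, Q⁆ = ⊥ := by
  induction hK with
  | top => rwa [inf_top_eq] at h
  | step K L hle _ hn ih =>
    have hLK : L ≤ Subgroup.normalizer (K : Set G) :=
      (Subgroup.normal_subgroupOf_iff_le_normalizer hle).1 hn
    have hcomm : ⁅N ⊓ L, Q⁆ ≤ N ⊓ K :=
      le_inf ((Subgroup.commutator_mono inf_le_left le_rfl).trans (Subgroup.commutator_le_left N Q))
        ((Subgroup.commutator_mono inf_le_right hQ).trans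
          (Subgroup.le_normalizer_iff_commutator_le_right.1 hLK))
    refine ih (hQ.trans hle) (commutator_eq_bot_of_isPerfect ?_)
    exact le_bot_iff.1 (h ▸ Subgroup.commutator_mono hcomm le_rfl)

end Commutator

/-- A component: a subnormal quasisimple subgroup. -/
def IsComponent {G : Type u} [Group G] (Q : Subgroup G) : Prop :=
  Q.IsSubnormal ∧ IsQuasisimple Q

namespace IsComponent

variable {G : Type u} [Group G] {P Q : Subgroup G}

theorem map_equiv {H : Type u} [Group H] (hQ : IsComponent Q) (e : G ≃* H) :
    IsComponent (Q.map e.toMonoidHom) :=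
  ⟨hQ.1.map e.surjective, hQ.2.of_equiv (e.subgroupMap Q)⟩

theorem subgroupOf (hQ : IsComponent Q) {K : Subgroup G} (hle : Q ≤ K) :
    IsComponent (Q.subgroupOf K) :=
  ⟨hQ.1.subgroupOf, hQ.2.of_equiv (Subgroup.subgroupOfEquivOfLe hle).symm⟩

theorem map_subtype {K : Subgroup G} (hK : K.IsSubnormal) {Q : Subgroup K} (hQ : IsComponent Q) :
    IsComponent (Q.map K.subtype) :=
  ⟨hQ.1.trans' hK, hQ.2.of_equiv (Q.equivMapOfInjective _ K.subtype_injective)⟩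

theorem le_or_commutator_eq_bot_of_normal (hQ : IsComponent Q) (N : Subgroup G) [N.Normal] :
    Q ≤ N ∨ ⁅N, Q⁆ = ⊥ := by
  have := hQ.2.isPerfect
  refine or_iff_not_imp_left.2 fun hle => commutator_eq_bot_of_inf_isSubnormal hQ.1 le_rfl ?_
  have hcenter : N.subgroupOf Q ≤ Subgroup.center Q :=
    hQ.2.le_center_of_normal _ fun h => hle (Subgroup.subgroupOf_eq_top.1 h)
  refine Subgroup.commutator_eq_bot_iff_le_centralizer.2 fun x hx y hy => ?_
  exact congrArg Subtype.val (Subgroup.mem_center_iff.1 (@hcenter ⟨x, hx.2⟩ hx.1) ⟨y, hy⟩)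

theorem le_or_commutator_eq_bot {N : Subgroup G} (hQ : IsComponent Q) (hN : N.IsSubnormal) :
    Q ≤ N ∨ ⁅N, Q⁆ = ⊥ := by
  induction hN with
  | top => exact Or.inl le_top
  | step N L hle _ hn ih =>
    rcases ih with hQL | hQL
    · refine ((hQ.subgroupOf hQL).le_or_commutator_eq_bot_of_normal (N.subgroupOf L)).imp
        (fun h x hx => @h ⟨x, hQL hx⟩ hx) fun hcomm => ?_
      rw [← Subgroup.map_subgroupOf_eq_of_le hle, ← Subgroup.map_subgroupOf_eq_of_le hQL,
        ← Subgroup.map_commutator, hcomm, Subgroup.map_bot]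
    · exact Or.inr (le_bot_iff.1 (hQL ▸ Subgroup.commutator_mono hle le_rfl))

theorem eq_or_commutator_eq_bot (hP : IsComponent P) (hQ : IsComponent Q) :
    P = Q ∨ ⁅P, Q⁆ = ⊥ := by
  rcases hP.le_or_commutator_eq_bot hQ.1 with hPQ | hPQ
  · exact (hQ.le_or_commutator_eq_bot hP.1).imp_left (le_antisymm hPQ)
  · exact Or.inr (by rwa [Subgroup.commutator_comm])

theorem commutator_fitting_eq_bot [Finite G] (hQ : IsComponent Q) : ⁅fitting G, Q⁆ = ⊥ := by
  refine (hQ.le_or_commutator_eq_bot_of_normal (fitting G)).resolve_left fun h => ?_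
  have := isNilpotent_fitting (G := G)
  exact hQ.2.not_isSolvable
    (Group.isSolvable_of_isSolvable_injective (Subgroup.inclusion_injective h))

end IsComponent

/-! ### Quasinilpotent groups -/

/-- A group is quasinilpotent if it coincides with its generalized Fitting subgroup. -/
def IsQuasinilpotent : GroupClass.{u} := fun G _ => genFitting G = ⊤

/-- The product of the components contained in `N`. -/
def layerInside {G : Type u} [Group G] (N : Subgroup G) : Subgroup G :=
  sSup {Q : Subgroup G | IsComponent Q ∧ Q ≤ N}

/-- The product of the components not contained in `N`; for normal `N` they all centralize `N`. -/
def layerOutside {G : Type u} [Group G] (N : Subgroup G) : Subgroup G :=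
  sSup {Q : Subgroup G | IsComponent Q ∧ ¬ Q ≤ N}

section GenFitting

variable {G : Type u} [Group G] {K N : Subgroup G}

instance instNormalGenFitting : (genFitting G).Normal := genFitting_normal G

theorem genFitting_le_iff : genFitting G ≤ K ↔ fitting G ≤ K ∧ ∀ Q, IsComponent Q → Q ≤ K :=
  sup_le_iff.trans (and_congr_right' sSup_le_iff)

theorem fitting_le_genFitting : fitting G ≤ genFitting G :=
  le_sup_left

theorem IsComponent.le_genFitting {Q : Subgroup G} (hQ : IsComponent Q) : Q ≤ genFitting G :=
  (genFitting_le_iff.1 le_rfl).2 Q hQ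

theorem IsComponent.le_map_genFitting {Q : Subgroup G} (hQ : IsComponent Q) (hle : Q ≤ N) :
    Q ≤ (genFitting N).map N.subtype := by
  rw [← Subgroup.map_subgroupOf_eq_of_le hle]
  exact Subgroup.map_mono (hQ.subgroupOf hle).le_genFitting

theorem le_map_genFitting_of_isNilpotent [Finite G] (hK : K.IsSubnormal)
    (h : Group.IsNilpotent K) (hle : K ≤ N) : K ≤ (genFitting N).map N.subtype := by
  rw [← Subgroup.map_subgroupOf_eq_of_le hle]
  exact Subgroup.map_mono ((le_fitting_of_isSubnormal hK.subgroupOf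
    (isFittingFormation_isNilpotent.subgroupOf hle h)).trans fitting_le_genFitting)

theorem isQuasinilpotent_of_le_map_genFitting (h : N ≤ (genFitting N).map N.subtype) :
    IsQuasinilpotent N :=
  top_le_iff.1 ((Subgroup.map_le_map_iff_of_injective N.subtype_injective).1
    (by rwa [← MonoidHom.range_eq_map, Subgroup.range_subtype]))

theorem map_genFitting_subtype_le [Finite G] (hK : K.IsSubnormal) :
    (genFitting K).map K.subtype ≤ genFitting G := by
  refine Subgroup.map_le_iff_le_comap.2 (genFitting_le_iff.2 ⟨?_, fun Q hQ => ?_⟩) <;>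
    rw [← Subgroup.map_le_iff_le_comap]
  · exact (le_fitting_of_isSubnormal (fitting_normal.isSubnormal.trans' hK)
      (isFittingFormation_isNilpotent.map _ _ isNilpotent_fitting)).trans fitting_le_genFitting
  · exact (hQ.map_subtype hK).le_genFitting

theorem IsQuasinilpotent.le_genFitting [Finite G] (h : IsQuasinilpotent K) (hK : K.IsSubnormal) :
    K ≤ genFitting G := by
  have hmap := map_genFitting_subtype_le hK
  rwa [show genFitting K = ⊤ from h, ← MonoidHom.range_eq_map, Subgroup.range_subtype] at hmap

theorem map_genFitting_le {H : Type u} [Group H] [Finite G] (f : G →* H)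
    (hf : Function.Surjective f) : (genFitting G).map f ≤ genFitting H := by
  refine Subgroup.map_le_iff_le_comap.2 (genFitting_le_iff.2 ⟨?_, fun Q hQ => ?_⟩) <;>
    rw [← Subgroup.map_le_iff_le_comap]
  · exact (isFittingFormation_isNilpotent.map_radical_le f hf).trans fitting_le_genFitting
  · cases subsingleton_or_nontrivial (Q.map f)
    · rw [Subgroup.eq_bot_of_subsingleton (Q.map f)]
      exact bot_le
    · exact IsComponent.le_genFitting
        ⟨hQ.1.map hf, hQ.2.of_surjective (f.subgroupMap Q) (f.subgroupMap_surjective Q)⟩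

end GenFitting

section Layer

variable {G : Type u} [Group G] (N : Subgroup G)

theorem map_conj_le_iff [N.Normal] (Q : Subgroup G) (g : G) :
    Q.map (MulAut.conj g).toMonoidHom ≤ N ↔ Q ≤ N := by
  conv_lhs => rw [← Subgroup.Normal.map_conj_eq N g]
  exact Subgroup.map_le_map_iff_of_injective (MulAut.conj g).injective

instance layerInside_normal [N.Normal] : (layerInside N).Normal :=
  sSup_normal_of_conj _ fun Q hQ g => ⟨hQ.1.map_equiv _, (map_conj_le_iff N Q g).2 hQ.2⟩

instance layerOutside_normal [N.Normal] : (layerOutside N).Normal :=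
  sSup_normal_of_conj _ fun Q hQ g => ⟨hQ.1.map_equiv _, (map_conj_le_iff N Q g).not.2 hQ.2⟩

theorem layerInside_le : layerInside N ≤ N :=
  sSup_le fun _ hQ => hQ.2

theorem layerInside_le_map_genFitting : layerInside N ≤ (genFitting N).map N.subtype :=
  sSup_le fun _ hQ => hQ.1.le_map_genFitting hQ.2

theorem commutator_layerOutside_eq_bot [N.Normal] : ⁅N, layerOutside N⁆ = ⊥ := by
  rw [Subgroup.commutator_comm, Subgroup.commutator_eq_bot_iff_le_centralizer]
  refine sSup_le fun Q hQ => ?_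
  rw [← Subgroup.commutator_eq_bot_iff_le_centralizer, Subgroup.commutator_comm]
  exact (hQ.1.le_or_commutator_eq_bot_of_normal N).resolve_left hQ.2

theorem commutator_fitting_layerOutside_eq_bot [Finite G] : ⁅fitting G, layerOutside N⁆ = ⊥ := by
  rw [Subgroup.commutator_comm, Subgroup.commutator_eq_bot_iff_le_centralizer]
  refine sSup_le fun Q hQ => ?_
  rw [← Subgroup.commutator_eq_bot_iff_le_centralizer, Subgroup.commutator_comm]
  exact hQ.1.commutator_fitting_eq_bot

theorem genFitting_le_layer : genFitting G ≤ layerInside N ⊔ (fitting G ⊔ layerOutside N) := by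
  refine genFitting_le_iff.2 ⟨le_sup_left.trans le_sup_right, fun Q hQ => ?_⟩
  by_cases hQN : Q ≤ N
  · exact (le_sSup ⟨hQ, hQN⟩ : Q ≤ layerInside N).trans le_sup_left
  · exact (le_sSup ⟨hQ, hQN⟩ : Q ≤ layerOutside N).trans (le_sup_right.trans le_sup_right)

open scoped IsMulCommutative in
theorem inf_centralizer_self_le_fitting (D : Subgroup G) [D.Normal] :
    D ⊓ Subgroup.centralizer (D : Set G) ≤ fitting G :=
  have : IsMulCommutative ↥(D ⊓ Subgroup.centralizer (D : Set G)) :=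
    ⟨⟨fun a b => Subtype.ext (b.2.2 a a.2.1)⟩⟩
  le_radical (C := Group.IsNilpotent) _ inferInstance

-- `f * d` and `f` commute with the components outside `N`, hence so does `d`.
theorem fitting_sup_layerOutside_inf_le [Finite G] [N.Normal] :
    (fitting G ⊔ layerOutside N) ⊓ N ≤ fitting G := by
  rintro _ ⟨hx, hxN⟩
  obtain ⟨f, hf, d, hd, rfl⟩ := Subgroup.mem_sup_of_normal_left.1 hx
  have hcent {L : Subgroup G} (hL : ⁅L, layerOutside N⁆ = ⊥) :
      L ≤ Subgroup.centralizer (layerOutside N : Set G) :=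
    Subgroup.commutator_eq_bot_iff_le_centralizer.1 hL
  have hfc := hcent (commutator_fitting_layerOutside_eq_bot N) hf
  have hfdc := hcent (commutator_layerOutside_eq_bot N) hxN
  exact mul_mem hf (inf_centralizer_self_le_fitting (layerOutside N)
    ⟨hd, (Subgroup.mul_mem_cancel_left _ hfc).1 hfdc⟩)

end Layer

theorem IsQuasinilpotent.of_normal {G : Type u} [Group G] [Finite G] (hG : IsQuasinilpotent G)
    (N : Subgroup G) [N.Normal] : IsQuasinilpotent N := by
  have := isNilpotent_fitting (G := G)
  have hfitting : fitting G ⊓ N ≤ (genFitting N).map N.subtype :=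
    le_map_genFitting_of_isNilpotent (Subgroup.Normal.isSubnormal inferInstance)
      (Group.nilpotent_of_mulEquiv (Subgroup.inf_subgroupOf_left N (fitting G) ▸
        Subgroup.subgroupOfEquivOfLe inf_le_left)) inf_le_right
  refine isQuasinilpotent_of_le_map_genFitting fun x hx => ?_
  have htop : x ∈ layerInside N ⊔ (fitting G ⊔ layerOutside N) :=
    genFitting_le_layer N (hG.ge (Subgroup.mem_top x))
  obtain ⟨c, hc, y, hy, rfl⟩ := Subgroup.mem_sup_of_normal_left.1 htop
  have hyN : y ∈ N := (N.mul_mem_cancel_left (layerInside_le N hc)).1 hx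
  exact mul_mem (layerInside_le_map_genFitting N hc)
    (hfitting ⟨fitting_sup_layerOutside_inf_le N ⟨hy, hyN⟩, hyN⟩)

theorem isFittingFormation_isQuasinilpotent : IsFittingFormation.{u} IsQuasinilpotent where
  of_subsingleton _ _ _ := Subsingleton.elim (α := Subgroup _) _ _
  of_surjective f hf h := top_le_iff.1 <| by
    simpa only [show genFitting _ = ⊤ from h, Subgroup.map_top_of_surjective f hf]
      using map_genFitting_le f hf
  of_normal N _ h := h.of_normal N
  of_sup_eq_top _ _ hM hN hCM hCN h :=
    top_le_iff.1 (h ▸ sup_le (hCM.le_genFitting hM.isSubnormal) (hCN.le_genFitting hN.isSubnormal))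

section Simple

variable (G : Type u) [Group G] [Finite G]

theorem genFitting_eq_radical : genFitting G = radical IsQuasinilpotent G := by
  refine le_antisymm (le_radical _ (isQuasinilpotent_of_le_map_genFitting ?_))
    (sSup_le fun N hN => hN.2.le_genFitting hN.1.isSubnormal)
  exact genFitting_le_iff.2 ⟨le_map_genFitting_of_isNilpotent fitting_normal.isSubnormal
    isNilpotent_fitting fitting_le_genFitting, fun Q hQ => hQ.le_map_genFitting hQ.le_genFitting⟩

theorem exists_isSubnormal_isSimpleGroup [Nontrivial G] :
    ∃ K : Subgroup G, K.IsSubnormal ∧ IsSimpleGroup K := by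
  obtain ⟨K, hK⟩ := (Set.toFinite {K : Subgroup G | K.IsSubnormal ∧ K ≠ ⊥}).exists_minimal
    ⟨⊤, Subgroup.IsSubnormal.top, top_ne_bot⟩
  have : Nontrivial K := (Subgroup.nontrivial_iff_ne_bot K).2 hK.prop.2
  refine ⟨K, hK.prop.1, ⟨fun A hA => or_iff_not_imp_left.2 fun hne => ?_⟩⟩
  have hle : K ≤ A.map K.subtype := hK.le_of_le
    ⟨hA.isSubnormal.trans' hK.prop.1, fun h =>
      hne ((Subgroup.map_eq_bot_iff_of_injective _ K.subtype_injective).1 h)⟩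
    (Subgroup.map_subtype_le A)
  exact top_le_iff.1 ((Subgroup.map_le_map_iff_of_injective K.subtype_injective).1
    (by rwa [← MonoidHom.range_eq_map, Subgroup.range_subtype]))

open scoped IsMulCommutative in
theorem genFitting_ne_bot [Nontrivial G] : genFitting G ≠ ⊥ := by
  obtain ⟨K, hK, hs⟩ := exists_isSubnormal_isSimpleGroup G
  refine ne_bot_of_le_ne_bot ((Subgroup.nontrivial_iff_ne_bot K).1 hs.toNontrivial) ?_
  by_cases hc : ∃ a b : K, a * b ≠ b * a
  · exact IsComponent.le_genFitting ⟨hK, IsNonabelianSimple.isQuasisimple ⟨hs, hc⟩⟩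
  · push Not at hc
    have : IsMulCommutative K := ⟨⟨hc⟩⟩
    exact (le_fitting_of_isSubnormal hK inferInstance).trans fitting_le_genFitting

end Simple

/-! ### The generalized Fitting series -/

section Radical

variable {C D : GroupClass.{u}} {G : Type u} [Group G] [Finite G]

/-- The factor between the radicals of `C` and of the `C`-by-`D` groups is the `D`-radical of the
quotient by the first. -/
noncomputable def radicalExtensionClassQuotientEquiv (hC : IsFittingFormation C)
    (hD : IsFittingFormation D) :
    radical (ExtensionClass C D) G ⧸ (radical C G).subgroupOf (radical (ExtensionClass C D) G) ≃*
      radical D (G ⧸ radical C G) :=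
  (quotientSubgroupOfEquivMap _ _).trans <| MulEquiv.subgroupCongr <| by
    rw [hC.radical_extensionClass hD,
      Subgroup.map_comap_eq_self_of_surjective (QuotientGroup.mk'_surjective _)]

theorem IsFittingFormation.radical_quotient_eq_bot (hC : IsFittingFormation C)
    (hD : IsFittingFormation D) (h : radical (ExtensionClass C D) G ≤ radical C G) :
    radical D (G ⧸ radical C G) = ⊥ := by
  have hmap := Subgroup.map_mono (f := QuotientGroup.mk' (radical C G)) h
  rwa [hC.radical_extensionClass hD, QuotientGroup.map_mk'_self, le_bot_iff,
    Subgroup.map_comap_eq_self_of_surjective (QuotientGroup.mk'_surjective _)] at hmap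

theorem IsFittingFormation.mem_of_radical_extensionClass_le (hC : IsFittingFormation C)
    (h : radical (ExtensionClass C IsQuasinilpotent) G ≤ radical C G) : C G := by
  by_contra hG
  have := QuotientGroup.nontrivial_iff.2 (hC.radical_eq_top_iff.not.2 hG)
  refine genFitting_ne_bot (G ⧸ radical C G) ?_
  rw [genFitting_eq_radical, hC.radical_quotient_eq_bot isFittingFormation_isQuasinilpotent h]

theorem exists_mem_of_radical_extensionClass_le {C : ℕ → GroupClass.{u}}
    (hC : ∀ i, IsFittingFormation (C i))
    (hle : ∀ i, radical (C i) G ≤ radical (ExtensionClass (C i) IsQuasinilpotent) G)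
    (hstep : ∀ i, radical (ExtensionClass (C i) IsQuasinilpotent) G ≤ radical (C (i + 1)) G) :
    ∃ i, C i G := by
  by_contra! h
  have hmono : StrictMono fun i => radical (C i) G := strictMono_nat_of_lt_succ fun i =>
    ((hle i).lt_of_not_ge fun hge => h i ((hC i).mem_of_radical_extensionClass_le hge)).trans_le
      (hstep i)
  exact not_injective_infinite_finite _ hmono.injective

end Radical

section GenFittingSeries

variable (G : Type u) [Group G] [Finite G]

theorem comap_genFitting_eq_radical {C : GroupClass.{u}} (hC : IsFittingFormation C)
    (N : Subgroup G) [N.Normal] (hN : N = radical C G) :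
    (genFitting (G ⧸ N)).comap (QuotientGroup.mk' N) =
      radical (ExtensionClass C IsQuasinilpotent) G := by
  subst hN
  rw [genFitting_eq_radical, hC.radical_extensionClass isFittingFormation_isQuasinilpotent]

theorem genFittingSeries_eq_radical (k : ℕ) :
    genFittingSeries G k = radical (iterExtension (fun _ => IsQuasinilpotent) k) G := by
  induction k with
  | zero => exact (radical_iterExtension_zero G).symm
  | succ k ih =>
    have := (genFittingSeriesAux G k).2
    exact comap_genFitting_eq_radical G (isFittingFormation_iterExtension
      (fun _ => isFittingFormation_isQuasinilpotent) k) _ ih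

theorem genFittingSeries_eq_top_iff (k : ℕ) :
    genFittingSeries G k = ⊤ ↔ iterExtension (fun _ => IsQuasinilpotent) k G := by
  rw [genFittingSeries_eq_radical, (isFittingFormation_iterExtension
    (fun _ => isFittingFormation_isQuasinilpotent) k).radical_eq_top_iff]

theorem iterExtension_genFittingHeight :
    iterExtension (fun _ => IsQuasinilpotent) (genFittingHeight G) G := by
  have hX (_ : ℕ) := isFittingFormation_isQuasinilpotent.{u}
  obtain ⟨k, hk⟩ := exists_mem_of_radical_extensionClass_le (G := G)
    (isFittingFormation_iterExtension hX) (radical_iterExtension_le_succ G hX) fun _ => le_rfl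
  have hne : {h | genFittingSeries G h = ⊤}.Nonempty := ⟨k, (genFittingSeries_eq_top_iff G k).2 hk⟩
  exact (genFittingSeries_eq_top_iff G _).1 (Nat.sInf_mem hne)

end GenFittingSeries

/-! ### Internal direct products of simple groups -/

section InternalProduct

variable {G : Type u} [Group G] {ι : Type*} {S : ι → Subgroup G}

theorem iSupIndep_of_commute (hS : ∀ i, Subgroup.center (S i) = ⊥)
    (hcomm : Pairwise fun i j => ∀ x y : G, x ∈ S i → y ∈ S j → Commute x y) : iSupIndep S := by
  refine fun i => disjoint_iff_inf_le.2 fun x ⟨hx, hx'⟩ => ?_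
  have hcent : (⨆ (j) (_ : j ≠ i), S j) ≤ Subgroup.centralizer (S i : Set G) :=
    iSup₂_le fun j hj y hy z hz => hcomm hj.symm z y hz hy
  have hx_center : (⟨x, hx⟩ : S i) ∈ Subgroup.center (S i) :=
    Subgroup.mem_center_iff.2 fun g => Subtype.ext (hcent hx' g g.2)
  rw [hS i, Subgroup.mem_bot] at hx_center
  exact congrArg Subtype.val hx_center

/-- The internal direct product of pairwise commuting subgroups with trivial centres. -/
noncomputable def internalProductEquiv [Fintype ι] (hS : ∀ i, Subgroup.center (S i) = ⊥)
    (hcomm : Pairwise fun i j => ∀ x y : G, x ∈ S i → y ∈ S j → Commute x y) :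
    (∀ i, S i) ≃* ↥(⨆ i, S i) :=
  (MonoidHom.ofInjective (Subgroup.injective_noncommPiCoprod_of_iSupIndep
    (hcomm := hcomm) (iSupIndep_of_commute hS hcomm))).trans
    (MulEquiv.subgroupCongr Subgroup.noncommPiCoprod_range)

theorem internalProductEquiv_mulSingle [Fintype ι] [DecidableEq ι]
    (hS : ∀ i, Subgroup.center (S i) = ⊥)
    (hcomm : Pairwise fun i j => ∀ x y : G, x ∈ S i → y ∈ S j → Commute x y) (i : ι) (x : S i) :
    (internalProductEquiv hS hcomm (Pi.mulSingle i x) : G) = x :=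
  Subgroup.noncommPiCoprod_mulSingle (hcomm := hcomm) i x

end InternalProduct

section ProductOfSimple

variable {G : Type u} [Group G]

theorem IsComponent.commute {P Q : Subgroup G} (hP : IsComponent P) (hQ : IsComponent Q)
    (hne : P ≠ Q) (x y : G) (hx : x ∈ P) (hy : y ∈ Q) : Commute x y :=
  (Subgroup.commutator_eq_bot_iff_le_centralizer.1
    ((hP.eq_or_commutator_eq_bot hQ).resolve_left hne) hx y hy).symm

theorem IsProductOfNonabelianSimple.of_equiv {H : Type u} [Group H] (e : G ≃* H)
    (h : IsProductOfNonabelianSimple G) : IsProductOfNonabelianSimple H := by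
  obtain ⟨r, T, hT, hsimple, ⟨f⟩⟩ := h
  exact ⟨r, T, hT, hsimple, ⟨e.symm.trans f⟩⟩

variable [Finite G]

open scoped IsMulCommutative in
theorem IsComponent.isNonabelianSimple {Q : Subgroup G} (hQ : IsComponent Q)
    (hF : fitting G = ⊥) : IsNonabelianSimple Q := by
  have hcenter : Subgroup.center Q = ⊥ := by
    rw [← Subgroup.map_eq_bot_iff_of_injective _ Q.subtype_injective, ← le_bot_iff, ← hF]
    exact le_fitting_of_isSubnormal
      (Subgroup.IsSubnormal.trans' (Subgroup.Normal.isSubnormal inferInstance) hQ.1)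
      (isFittingFormation_isNilpotent.map Q.subtype _ inferInstance)
  exact hQ.2.2.of_equiv
    ((QuotientGroup.quotientMulEquivOfEq hcenter).trans QuotientGroup.quotientBot)

theorem isProductOfNonabelianSimple_genFitting (hF : fitting G = ⊥) :
    IsProductOfNonabelianSimple (genFitting G) := by
  let 𝒬 := {Q : Subgroup G // IsComponent Q}
  let e : 𝒬 ≃ Fin (Nat.card 𝒬) := Finite.equivFin 𝒬
  let S : Fin (Nat.card 𝒬) → Subgroup G := fun i => (e.symm i).1
  have hS (i) : IsNonabelianSimple (S i) := (e.symm i).2.isNonabelianSimple hF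
  have hcomm : Pairwise fun i j => ∀ x y : G, x ∈ S i → y ∈ S j → Commute x y := fun i j hij =>
    (e.symm i).2.commute (e.symm j).2 fun h => hij (e.symm.injective (Subtype.ext h))
  have hsup : (⨆ i, S i) = genFitting G := by
    rw [genFitting, hF, bot_sup_eq, sSup_eq_iSup']
    exact e.symm.iSup_comp (g := fun Q : 𝒬 => Q.1)
  exact ⟨_, fun i => S i, inferInstance, hS, ⟨((internalProductEquiv
    (fun i => (hS i).center_eq_bot) hcomm).trans (MulEquiv.subgroupCongr hsup)).symm⟩⟩

end ProductOfSimple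

theorem mulSingle_range_normal {ι : Type*} [DecidableEq ι] (T : ι → Type*) [∀ i, Group (T i)]
    (i : ι) : (MonoidHom.mulSingle T i).range.Normal := by
  refine ⟨?_⟩
  rintro _ ⟨y, rfl⟩ g
  refine ⟨g i * y * (g i)⁻¹, funext fun j => ?_⟩
  rcases eq_or_ne j i with rfl | hj
  · simp
  · simp [Pi.mulSingle_eq_of_ne hj]

theorem IsProductOfNonabelianSimple.isQuasinilpotent {G : Type u} [Group G] [Finite G]
    (h : IsProductOfNonabelianSimple G) : IsQuasinilpotent G := by
  obtain ⟨r, T, _, hT, ⟨e⟩⟩ := h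
  have : Finite (∀ i, T i) := Finite.of_equiv G e.toEquiv
  have hcomponent (i) : IsComponent (MonoidHom.mulSingle T i).range :=
    ⟨(mulSingle_range_normal T i).isSubnormal, (hT i).isQuasisimple.of_equiv
      (MonoidHom.ofInjective (f := MonoidHom.mulSingle T i) (Pi.mulSingle_injective i))⟩
  exact isFittingFormation_isQuasinilpotent.of_mulEquiv e.symm <| top_le_iff.1 fun x _ =>
    Subgroup.pi_mem_of_mulSingle_mem x fun i => (hcomponent i).le_genFitting ⟨x i, rfl⟩

/-! ### Nonsoluble length -/

theorem ExtensionClass.mono_right {C D E : GroupClass.{u}} {G : Type u} [Group G] [Finite G]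
    (hDE : ∀ (H : Type u) [Group H] [Finite H], D H → E H) (h : ExtensionClass C D G) :
    ExtensionClass C E G := by
  obtain ⟨N, hN, hC, hD⟩ := h
  exact ⟨N, hN, hC, hDE _ hD⟩

theorem IsFittingFormation.extensionClass_of_le {C D : GroupClass.{u}} (hC : IsFittingFormation C)
    {G : Type u} [Group G] [Finite G] {A B : Subgroup G} [A.Normal] (hle : A ≤ B) (hA : C A)
    (hD : D (B ⧸ A.subgroupOf B)) : ExtensionClass C D B :=
  ⟨A.subgroupOf B, inferInstance, hC.subgroupOf hle hA, hD⟩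

theorem iterExtension_mono {D : ℕ → GroupClass.{u}} (hD : ∀ j, IsFittingFormation (D j))
    {G : Type u} [Group G] [Finite G] {i j : ℕ} (hij : i ≤ j) (h : iterExtension D i G) :
    iterExtension D j G := by
  rw [← (isFittingFormation_iterExtension hD _).radical_eq_top_iff] at h ⊢
  exact top_le_iff.1
    (h ▸ monotone_nat_of_le_succ (radical_iterExtension_le_succ G hD) hij)

open Classical in
/-- The soluble groups at even indices, the quasinilpotent groups at odd ones. -/
def solubleQuasinilpotent (j : ℕ) : GroupClass.{u} :=
  if Even j then Group.IsSolvable else IsQuasinilpotent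

/-- The soluble-by-quasinilpotent-by-…-by-soluble groups with `k` quasinilpotent layers; the finite
ones are those of nonsoluble length at most `k`. -/
def NonsolubleClass (k : ℕ) : GroupClass.{u} := iterExtension solubleQuasinilpotent (2 * k + 1)

theorem solubleQuasinilpotent_of_even {j : ℕ} (hj : Even j) :
    solubleQuasinilpotent.{u} j = Group.IsSolvable :=
  if_pos hj

theorem solubleQuasinilpotent_of_odd {j : ℕ} (hj : Odd j) :
    solubleQuasinilpotent.{u} j = IsQuasinilpotent :=
  if_neg (Nat.not_even_iff_odd.2 hj)

theorem isFittingFormation_solubleQuasinilpotent (j : ℕ) :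
    IsFittingFormation.{u} (solubleQuasinilpotent j) := by
  unfold solubleQuasinilpotent
  split_ifs
  exacts [isFittingFormation_isSolvable, isFittingFormation_isQuasinilpotent]

theorem isFittingFormation_nonsolubleClass (k : ℕ) : IsFittingFormation (NonsolubleClass.{u} k) :=
  isFittingFormation_iterExtension isFittingFormation_solubleQuasinilpotent _

theorem iterExtension_solubleQuasinilpotent_two_mul_add_two (k : ℕ) :
    iterExtension.{u} solubleQuasinilpotent (2 * k + 2) =
      ExtensionClass (NonsolubleClass k) IsQuasinilpotent := by
  rw [iterExtension, solubleQuasinilpotent_of_odd (odd_two_mul_add_one k), NonsolubleClass]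

section NonsolubleClass

variable {G : Type u} [Group G] [Finite G]

theorem NonsolubleClass.mono {k l : ℕ} (hkl : k ≤ l) (h : NonsolubleClass k G) :
    NonsolubleClass l G :=
  iterExtension_mono isFittingFormation_solubleQuasinilpotent (by lia) h

theorem nonsolubleClass_succ_of_isQuasinilpotent {k : ℕ}
    (h : ExtensionClass (NonsolubleClass k) IsQuasinilpotent G) : NonsolubleClass (k + 1) G := by
  rw [← iterExtension_solubleQuasinilpotent_two_mul_add_two] at h
  exact iterExtension_mono isFittingFormation_solubleQuasinilpotent (by lia) h

theorem isSolvable_of_extensionClass {G : Type u} [Group G]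
    (h : ExtensionClass Group.IsSolvable Group.IsSolvable G) : Group.IsSolvable G := by
  obtain ⟨N, hN, hsub, hquot⟩ := h
  exact (Group.isSolvable_iff_subgroup_quotient N).2 ⟨hsub, hquot⟩

theorem nonsolubleClass_of_isSolvable {k : ℕ}
    (h : ExtensionClass (NonsolubleClass k) Group.IsSolvable G) : NonsolubleClass k G := by
  have hS := isFittingFormation_isSolvable.{u}
  have hk : NonsolubleClass.{u} k =
      ExtensionClass (iterExtension solubleQuasinilpotent (2 * k)) Group.IsSolvable := by
    rw [NonsolubleClass, iterExtension, solubleQuasinilpotent_of_even (even_two_mul k)]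
  rw [hk] at h ⊢
  exact (((isFittingFormation_iterExtension isFittingFormation_solubleQuasinilpotent
    _).extensionClass_assoc hS hS).1 h).mono_right fun _ _ _ => isSolvable_of_extensionClass

open Classical in
theorem SolubleSimpleSeries.nonsolubleClass_term (s : SolubleSimpleSeries G) :
    haveI := s.normal
    ∀ j ≤ s.length, NonsolubleClass (∑ i ∈ Finset.range j, if ¬ Group.IsSolvable
      (s.term (i + 1) ⧸ (s.term i).subgroupOf (s.term (i + 1))) then 1 else 0) (s.term j) := by
  have := s.normal
  intro j
  induction j with
  | zero =>
    rw [s.term_zero]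
    exact fun _ => (isFittingFormation_nonsolubleClass _).of_subsingleton _
  | succ j ih =>
    intro hj
    have hext {D : GroupClass.{u}} := (isFittingFormation_nonsolubleClass _).extensionClass_of_le
      (D := D) (s.mono j hj) (ih (Nat.le_of_succ_le hj))
    rw [Finset.sum_range_succ]
    split_ifs with hs
    · exact nonsolubleClass_of_isSolvable (hext hs)
    · exact nonsolubleClass_succ_of_isQuasinilpotent
        (hext ((s.factor j hj).resolve_left hs).isQuasinilpotent)

theorem SolubleSimpleSeries.nonsolubleClass (s : SolubleSimpleSeries G) :
    NonsolubleClass s.numNonsoluble G := by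
  have h := s.nonsolubleClass_term s.length le_rfl
  rw [s.term_length, ← Finset.card_filter] at h
  exact (isFittingFormation_nonsolubleClass _).of_mulEquiv Subgroup.topEquiv h

variable (G)

theorem fitting_quotient_radical_nonsolubleClass (k : ℕ) :
    fitting (G ⧸ radical (NonsolubleClass k) G) = ⊥ := by
  have hS := (isFittingFormation_nonsolubleClass k).radical_quotient_eq_bot
    isFittingFormation_isSolvable (G := G)
    (sSup_le_sSup fun N hN => ⟨hN.1, nonsolubleClass_of_isSolvable hN.2⟩)
  rw [← le_bot_iff, ← hS]
  exact sSup_le_sSup fun N hN => ⟨hN.1, have := hN.2; inferInstance⟩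

theorem isSolvable_radical_iterExtension_quotient {j : ℕ} (hj : Even j) :
    Group.IsSolvable (radical (iterExtension solubleQuasinilpotent (j + 1)) G ⧸
      (radical (iterExtension solubleQuasinilpotent j) G).subgroupOf
        (radical (iterExtension solubleQuasinilpotent (j + 1)) G)) := by
  have hD := isFittingFormation_solubleQuasinilpotent.{u}
  have hmem := (hD j).radical_mem (G := G ⧸ radical (iterExtension solubleQuasinilpotent j) G)
  refine isFittingFormation_isSolvable.of_mulEquiv (radicalExtensionClassQuotientEquiv
    (isFittingFormation_iterExtension hD j) (hD j)).symm ?_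
  rwa [solubleQuasinilpotent_of_even hj] at hmem ⊢

theorem isProductOfNonabelianSimple_radical_iterExtension_quotient {j : ℕ} (hj : Odd j) :
    IsProductOfNonabelianSimple (radical (iterExtension solubleQuasinilpotent (j + 1)) G ⧸
      (radical (iterExtension solubleQuasinilpotent j) G).subgroupOf
        (radical (iterExtension solubleQuasinilpotent (j + 1)) G)) := by
  have hD := isFittingFormation_solubleQuasinilpotent.{u}
  refine .of_equiv (radicalExtensionClassQuotientEquiv
    (isFittingFormation_iterExtension hD j) (hD j)).symm ?_
  rw [solubleQuasinilpotent_of_odd hj, ← genFitting_eq_radical]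
  obtain ⟨k, rfl⟩ := hj
  exact isProductOfNonabelianSimple_genFitting (fitting_quotient_radical_nonsolubleClass G k)

/-- The series of radicals of the alternating extension classes, for a group of nonsoluble length at
most `k`. -/
def upperNonsolubleSeries {k : ℕ} (h : NonsolubleClass k G) : SolubleSimpleSeries G where
  length := 2 * k + 1
  term j := radical (iterExtension solubleQuasinilpotent j) G
  normal _ := inferInstance
  mono j _ := radical_iterExtension_le_succ G isFittingFormation_solubleQuasinilpotent j
  term_zero := radical_iterExtension_zero G
  term_length := (isFittingFormation_nonsolubleClass k).radical_eq_top_iff.2 h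
  factor j _ := j.even_or_odd.imp (isSolvable_radical_iterExtension_quotient G)
    (isProductOfNonabelianSimple_radical_iterExtension_quotient G)

open Classical in
theorem numNonsoluble_upperNonsolubleSeries_le {k : ℕ} (h : NonsolubleClass k G) :
    (upperNonsolubleSeries G h).numNonsoluble ≤ k := by
  calc (upperNonsolubleSeries G h).numNonsoluble
      ≤ ((Finset.range k).image fun i => 2 * i + 1).card := by
        refine Finset.card_le_card fun j hj => ?_
        obtain ⟨hlt, hs⟩ := Finset.mem_filter.1 hj
        obtain ⟨i, rfl⟩ := (Nat.not_even_iff_odd (n := j)).1 fun heven =>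
          hs (isSolvable_radical_iterExtension_quotient G heven)
        have hi : 2 * i + 1 < 2 * k + 1 := Finset.mem_range.1 hlt
        exact Finset.mem_image.2 ⟨i, Finset.mem_range.2 (by lia), rfl⟩
    _ ≤ k := Finset.card_image_le.trans (Finset.card_range k).le

theorem exists_nonsolubleClass : ∃ k, NonsolubleClass k G := by
  have hle := radical_iterExtension_le_succ G isFittingFormation_solubleQuasinilpotent
  refine exists_mem_of_radical_extensionClass_le isFittingFormation_nonsolubleClass
    (fun k => ?_) fun k => ?_ <;> rw [← iterExtension_solubleQuasinilpotent_two_mul_add_two]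
  exacts [hle (2 * k + 1), hle (2 * k + 2)]

theorem nonsolubleLength_le_iff (k : ℕ) : nonsolubleLength G ≤ k ↔ NonsolubleClass k G := by
  refine ⟨fun h => ?_, fun h => (Nat.sInf_le (Set.mem_range_self (upperNonsolubleSeries G h))).trans
    (numNonsoluble_upperNonsolubleSeries_le G h)⟩
  obtain ⟨l, hl⟩ := exists_nonsolubleClass G
  obtain ⟨s, hs⟩ := Nat.sInf_mem (Set.range_nonempty_iff_nonempty.2 ⟨upperNonsolubleSeries G hl⟩ :
    (Set.range fun s : SolubleSimpleSeries G => s.numNonsoluble).Nonempty)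
  exact s.nonsolubleClass.mono (hs.le.trans h)

theorem nonsolubleRadical_eq_radical (k : ℕ) :
    nonsolubleRadical G k = radical (NonsolubleClass k) G :=
  congrArg sSup (Set.ext fun N => and_congr_right fun _ => nonsolubleLength_le_iff N k)

end NonsolubleClass

/-! ### Engel subgroups of automorphisms -/

section AutEngel

variable {G H : Type u} [Group G] [Group H] {α : MulAut G} {β : MulAut H}

theorem map_autEngelComm (f : G →* H) (hf : ∀ x, f (α x) = β (f x)) (n : ℕ) (x : G) :
    f (autEngelComm α n x) = autEngelComm β n (f x) :=
  (Function.Semiconj.iterate_right (f := f) (fun y => by simp [hf]) n) x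

theorem map_autEngelSubgroup_le (f : G →* H) (hf : ∀ x, f (α x) = β (f x)) (n : ℕ) :
    (autEngelSubgroup α n).map f ≤ autEngelSubgroup β n := by
  rw [autEngelSubgroup, MonoidHom.map_closure, Subgroup.closure_le]
  rintro _ ⟨_, ⟨x, rfl⟩, rfl⟩
  exact Subgroup.subset_closure ⟨f x, (map_autEngelComm f hf n x).symm⟩

theorem map_autEngelSubgroup_eq (f : G →* H) (hs : Function.Surjective f)
    (hf : ∀ x, f (α x) = β (f x)) (n : ℕ) :
    (autEngelSubgroup α n).map f = autEngelSubgroup β n := by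
  refine le_antisymm (map_autEngelSubgroup_le f hf n) ((Subgroup.closure_le _).2 ?_)
  rintro _ ⟨y, rfl⟩
  obtain ⟨x, rfl⟩ := hs y
  exact ⟨autEngelComm α n x, Subgroup.subset_closure ⟨x, rfl⟩, map_autEngelComm f hf n x⟩

theorem map_autEngelSubgroup_self (α : MulAut G) (n : ℕ) :
    (autEngelSubgroup α n).map α.toMonoidHom = autEngelSubgroup α n :=
  map_autEngelSubgroup_eq α.toMonoidHom α.surjective (fun _ => rfl) n

theorem autEngelSubgroup_one (α : MulAut G) : autEngelSubgroup α 1 = autCommutator α := rfl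

theorem map_autCommutator_eq (f : G →* H) (hs : Function.Surjective f)
    (hf : ∀ x, f (α x) = β (f x)) : (autCommutator α).map f = autCommutator β := by
  rw [← autEngelSubgroup_one, map_autEngelSubgroup_eq f hs hf, autEngelSubgroup_one]

theorem autEngelComm_surjective [Finite G] (h : MonoidHom.FixedPointFree α) (n : ℕ) :
    Function.Surjective (autEngelComm α n) := by
  have hsurj : Function.Surjective fun x : G => x⁻¹ * α x := by
    convert h.commutatorMap_surjective.comp inv_surjective using 2 with x
    simp [div_eq_mul_inv]
  exact hsurj.iterate n

theorem autEngelSubgroup_eq_top_of_fixedPointFree [Finite G] (h : MonoidHom.FixedPointFree α)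
    (n : ℕ) : autEngelSubgroup α n = ⊤ := by
  rw [autEngelSubgroup, (autEngelComm_surjective h n).range_eq, Subgroup.closure_univ]

/-- The restriction of an automorphism to an invariant subgroup. -/
def restrictAut (α : MulAut G) (K : Subgroup G) (hK : K.map α.toMonoidHom = K) : MulAut K :=
  (α.subgroupMap K).trans (MulEquiv.subgroupCongr hK)

theorem le_autEngelSubgroup_of_restrictAut {K : Subgroup G} (hK : K.map α.toMonoidHom = K) {n : ℕ}
    (h : autEngelSubgroup (restrictAut α K hK) n = ⊤) : K ≤ autEngelSubgroup α n := by
  have hmap := map_autEngelSubgroup_le (α := restrictAut α K hK) (β := α) K.subtype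
    (fun _ => rfl) n
  rwa [h, ← MonoidHom.range_eq_map, Subgroup.range_subtype] at hmap

theorem map_map_subtype_of_characteristic {K : Subgroup G} (hK : K.map α.toMonoidHom = K)
    (X : Subgroup K) [hX : X.Characteristic] :
    (X.map K.subtype).map α.toMonoidHom = X.map K.subtype := by
  conv_rhs => rw [← Subgroup.characteristic_iff_map_eq.1 hX (restrictAut α K hK)]
  rw [Subgroup.map_map, Subgroup.map_map]
  rfl

/-- The subgroup of fixed points of an automorphism. -/
def fixedSubgroup (α : MulAut G) : Subgroup G :=
  MonoidHom.eqLocus α.toMonoidHom (MonoidHom.id G)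

theorem mem_fixedSubgroup {x : G} : x ∈ fixedSubgroup α ↔ α x = x :=
  Iff.rfl

theorem map_eq_self_of_le_fixedSubgroup {K : Subgroup G} (hK : K ≤ fixedSubgroup α) :
    K.map α.toMonoidHom = K := by
  refine SetLike.coe_injective ((Set.image_congr fun x hx => ?_).trans (Set.image_id _))
  exact hK hx

theorem fixedSubgroup_le_normalizer (α : MulAut G) (n : ℕ) :
    fixedSubgroup α ≤ Subgroup.normalizer (autEngelSubgroup α n : Set G) := by
  refine Subgroup.le_normalizer_iff.2 fun c hc x hx => ?_
  refine map_autEngelSubgroup_le (α := α) (MulAut.conj c).toMonoidHom (fun y => ?_) n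
    (Subgroup.mem_map_of_mem _ hx)
  simp [mem_fixedSubgroup.1 hc]

theorem le_autEngelSubgroup_of_inf_fixedSubgroup_eq_bot [Finite G] {M : Subgroup G}
    (hM : M.map α.toMonoidHom = M) (h : M ⊓ fixedSubgroup α = ⊥) (n : ℕ) :
    M ≤ autEngelSubgroup α n := by
  refine le_autEngelSubgroup_of_restrictAut hM
    (autEngelSubgroup_eq_top_of_fixedPointFree (fun x hx => ?_) n)
  exact Subtype.ext (Subgroup.mem_bot.1 (h.le ⟨x.2, congrArg Subtype.val hx⟩))

theorem autEngelSubgroup_eq_top_of_sup_fixedSubgroup {n : ℕ} (hα : autCommutator α = ⊤)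
    (h : autEngelSubgroup α n ⊔ fixedSubgroup α = ⊤) : autEngelSubgroup α n = ⊤ := by
  have hnormal : (autEngelSubgroup α n).Normal := by
    rw [← Subgroup.normalizer_eq_top_iff, ← top_le_iff, ← h]
    exact sup_le Subgroup.le_normalizer (fixedSubgroup_le_normalizer α n)
  rw [← top_le_iff, ← hα, autCommutator, Subgroup.closure_le]
  rintro _ ⟨x, rfl⟩
  obtain ⟨e, he, c, hc, rfl⟩ := Subgroup.mem_sup_of_normal_left.1 (h.ge (Subgroup.mem_top x))
  have hαe : α e ∈ autEngelSubgroup α n :=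
    (map_autEngelSubgroup_self α n).le (Subgroup.mem_map_of_mem _ he)
  have hconj := hnormal.conj_mem _ (mul_mem (inv_mem he) hαe) c⁻¹
  simpa [mem_fixedSubgroup.1 hc, mul_assoc] using hconj

end AutEngel

/-! ### Orbits of components -/

theorem exists_fin_enumeration_of_sameCycle {X : Type*} [Finite X] (τ : Equiv.Perm X) (x : X) :
    ∃ (r : ℕ) (S : Fin r → X) (σ : Equiv.Perm (Fin r)), Function.Injective S ∧
      Set.range S = {y | τ.SameCycle x y} ∧ (∀ i, τ (S i) = S (σ i)) ∧ ∀ i j, σ.SameCycle i j := by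
  let O : Type _ := {y // τ.SameCycle x y}
  let e : O ≃ Fin (Nat.card O) := Finite.equivFin O
  let τO : Equiv.Perm O := τ.subtypePerm fun _ => Equiv.Perm.sameCycle_apply_right
  refine ⟨Nat.card O, fun i => (e.symm i).1, e.permCongr τO,
    Subtype.val_injective.comp e.symm.injective, ?_, fun i => ?_, fun i j => ?_⟩
  · exact (e.symm.surjective.range_comp _).trans Subtype.range_val
  · simp only [τO, Equiv.permCongr_apply, Equiv.symm_apply_apply]
    rfl
  · obtain ⟨k, hk⟩ : τO.SameCycle (e.symm i) (e.symm j) :=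
      Equiv.Perm.sameCycle_subtypePerm.2 ((e.symm i).2.symm.trans (e.symm j).2)
    refine ⟨k, ?_⟩
    rw [← Equiv.permCongrHom_coe, ← map_zpow, Equiv.permCongrHom_coe, Equiv.permCongr_apply, hk,
      Equiv.apply_symm_apply]

section Orbit

variable {n : ℕ}

theorem EngelGeneratesSimpleProducts.eq_one_or_autEngelSubgroup_eq_top
    (hS : EngelGeneratesSimpleProducts.{u} n) {r : ℕ} {T : Fin r → Type u} [∀ i, Group (T i)]
    [∀ i, Finite (T i)] (hT : ∀ i, IsNonabelianSimple (T i)) {P : Type u} [Group P]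
    (ψ : (∀ i, T i) ≃* P) (β : MulAut P) (σ : Equiv.Perm (Fin r)) (hσ : ∀ i j, σ.SameCycle i j)
    (hβ : ∀ i, ((MonoidHom.mulSingle T i).range.map ψ.toMonoidHom).map β.toMonoidHom =
      (MonoidHom.mulSingle T (σ i)).range.map ψ.toMonoidHom) :
    β = 1 ∨ autEngelSubgroup β n = ⊤ := by
  let φ : MulAut (∀ i, T i) := MulAut.congr ψ.symm β
  have hψφ (x) : ψ (φ x) = β (ψ x) := ψ.apply_symm_apply _
  have hperm : PermutesFactorsTransitively T φ := by
    refine ⟨σ, fun i => Subgroup.map_injective (f := ψ.toMonoidHom) ψ.injective ?_, hσ⟩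
    rw [← hβ, Subgroup.map_map, Subgroup.map_map]
    exact congrArg (fun f => Subgroup.map f _) (MonoidHom.ext hψφ)
  refine or_iff_not_imp_left.2 fun hne => ?_
  have hφ : φ ≠ 1 := (MulAut.congr ψ.symm).map_eq_one_iff.not.2 hne
  rw [← map_autEngelSubgroup_eq ψ.toMonoidHom ψ.surjective hψφ, hS r T hT φ hφ hperm,
    Subgroup.map_top_of_surjective _ ψ.surjective]

variable {G : Type u} [Group G] [Finite G]

theorem iSup_le_fixedSubgroup_or_le_autEngelSubgroup (hS : EngelGeneratesSimpleProducts.{u} n)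
    (α : MulAut G) {r : ℕ} {S : Fin r → Subgroup G} (hsimple : ∀ i, IsNonabelianSimple (S i))
    (hcomm : Pairwise fun i j => ∀ x y : G, x ∈ S i → y ∈ S j → Commute x y)
    (σ : Equiv.Perm (Fin r)) (hσ : ∀ i j, σ.SameCycle i j)
    (hα : ∀ i, (S i).map α.toMonoidHom = S (σ i)) :
    ⨆ i, S i ≤ fixedSubgroup α ∨ ⨆ i, S i ≤ autEngelSubgroup α n := by
  have hcenter (i) : Subgroup.center (S i) = ⊥ := (hsimple i).center_eq_bot
  let ψ := internalProductEquiv hcenter hcomm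
  have hinv : (⨆ i, S i).map α.toMonoidHom = ⨆ i, S i := by
    simp only [Subgroup.map_iSup, hα]
    exact σ.iSup_comp (g := S)
  have hfactor (i) : ((MonoidHom.mulSingle (fun i => S i) i).range.map ψ.toMonoidHom).map
      (⨆ i, S i).subtype = S i := by
    rw [MonoidHom.map_range, MonoidHom.map_range]
    exact (congrArg MonoidHom.range (MonoidHom.ext
      (internalProductEquiv_mulSingle hcenter hcomm i))).trans (S i).range_subtype
  have hperm (i) : ((MonoidHom.mulSingle (fun i => S i) i).range.map ψ.toMonoidHom).map
      (restrictAut α _ hinv).toMonoidHom =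
        (MonoidHom.mulSingle (fun i => S i) (σ i)).range.map ψ.toMonoidHom := by
    apply Subgroup.map_injective (⨆ i, S i).subtype_injective
    refine Eq.trans ?_ ((congrArg (Subgroup.map α.toMonoidHom) (hfactor i)).trans
      ((hα i).trans (hfactor (σ i)).symm))
    simp only [Subgroup.map_map]
    rfl
  refine (hS.eq_one_or_autEngelSubgroup_eq_top hsimple ψ _ σ hσ hperm).imp (fun h x hx => ?_)
    (le_autEngelSubgroup_of_restrictAut hinv)
  exact congrArg Subtype.val (DFunLike.congr_fun h ⟨x, hx⟩)

theorem le_fixedSubgroup_or_le_autEngelSubgroup (hS : EngelGeneratesSimpleProducts.{u} n)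
    (α : MulAut G) {Q : Subgroup G} (hsub : Q.IsSubnormal) (hQ : IsNonabelianSimple Q) :
    Q ≤ fixedSubgroup α ∨ Q ≤ autEngelSubgroup α n := by
  obtain ⟨r, S, σ, hinj, hrange, hα, hσ⟩ :=
    exists_fin_enumeration_of_sameCycle (MulEquiv.mapSubgroup α).toEquiv Q
  have horbit (i) : (S i).IsSubnormal ∧ IsNonabelianSimple (S i) := by
    obtain ⟨k, hk⟩ := (hrange.le ⟨i, rfl⟩).exists_nat_pow_eq
    rw [← hk]
    clear hk
    induction k with
    | zero => exact ⟨hsub, hQ⟩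
    | succ k ih =>
      rw [pow_succ']
      exact ⟨ih.1.map α.surjective, ih.2.of_equiv (α.subgroupMap _)⟩
  have hcomm : Pairwise fun i j => ∀ x y : G, x ∈ S i → y ∈ S j → Commute x y := fun i j hij =>
    IsComponent.commute ⟨(horbit i).1, (horbit i).2.isQuasisimple⟩
      ⟨(horbit j).1, (horbit j).2.isQuasisimple⟩ (hinj.ne hij)
  obtain ⟨i, rfl⟩ : Q ∈ Set.range S := hrange ▸ Equiv.Perm.SameCycle.refl _ Q
  exact (iSup_le_fixedSubgroup_or_le_autEngelSubgroup hS α (fun i => (horbit i).2) hcomm σ hσ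
    hα).imp (le_iSup S i).trans (le_iSup S i).trans

end Orbit

/-! ### Groups generated by commutators with an automorphism -/

section Generation

variable {n : ℕ} {G : Type u} [Group G] {α : MulAut G}

theorem inf_normal_of_sup_eq_top {E M : Subgroup G} [M.Normal] [IsMulCommutative M]
    (h : E ⊔ M = ⊤) : (E ⊓ M).Normal := by
  rw [← Subgroup.normalizer_eq_top_iff, ← top_le_iff, ← h]
  refine sup_le ?_ ?_
  · exact (le_inf Subgroup.le_normalizer Subgroup.le_normalizer_of_normal).trans
      Subgroup.inf_normalizer_le_normalizer_inf
  · exact ((Subgroup.le_centralizer M).trans (Subgroup.centralizer_le inf_le_right)).trans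
      (Subgroup.centralizer_le_normalizer _)

theorem inf_fixedSubgroup_le_center {M : Subgroup G} [M.Normal] [IsMulCommutative M]
    (hsup : autEngelSubgroup α n ⊔ M = ⊤) (hinf : autEngelSubgroup α n ⊓ M = ⊥) :
    M ⊓ fixedSubgroup α ≤ Subgroup.center G := by
  have hcomm : ⁅M ⊓ fixedSubgroup α, autEngelSubgroup α n⁆ = ⊥ := by
    rw [← le_bot_iff, ← hinf]
    refine le_inf ?_ ((Subgroup.commutator_mono inf_le_left le_top).trans
      (Subgroup.commutator_le_left M ⊤))
    exact Subgroup.le_normalizer_iff_commutator_le_right.1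
      (inf_le_right.trans (fixedSubgroup_le_normalizer α n))
  rw [← Subgroup.centralizer_univ, ← Subgroup.coe_top, Subgroup.le_centralizer_iff, ← hsup]
  refine sup_le ?_ ((Subgroup.le_centralizer M).trans (Subgroup.centralizer_le inf_le_left))
  exact Subgroup.le_centralizer_iff.1 (Subgroup.commutator_eq_bot_iff_le_centralizer.1 hcomm)

theorem autCommutator_quotient_eq_top (hα : autCommutator α = ⊤) {M : Subgroup G} [M.Normal]
    (hM : M.map α.toMonoidHom = M) : autCommutator (QuotientGroup.congr M M α hM) = ⊤ := by
  rw [← map_autCommutator_eq (QuotientGroup.mk' M) (QuotientGroup.mk'_surjective M) fun _ => rfl,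
    hα, Subgroup.map_top_of_surjective _ (QuotientGroup.mk'_surjective M)]

theorem autEngelSubgroup_sup_eq_top_of_quotient {M : Subgroup G} [M.Normal]
    (hM : M.map α.toMonoidHom = M)
    (h : autEngelSubgroup (QuotientGroup.congr M M α hM) n = ⊤) : autEngelSubgroup α n ⊔ M = ⊤ := by
  rw [← map_autEngelSubgroup_eq (QuotientGroup.mk' M) (QuotientGroup.mk'_surjective M)
    fun _ => rfl] at h
  rw [sup_comm, ← QuotientGroup.comap_map_mk', h, Subgroup.comap_top]

variable [Finite G]

theorem autEngelSubgroup_eq_top_of_fitting_eq_bot (hS : EngelGeneratesSimpleProducts.{u} n)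
    (hα : autCommutator α = ⊤) (hF : fitting G = ⊥)
    (hsup : autEngelSubgroup α n ⊔ genFitting G = ⊤) : autEngelSubgroup α n = ⊤ := by
  refine autEngelSubgroup_eq_top_of_sup_fixedSubgroup hα (top_le_iff.1 ?_)
  rw [← hsup]
  refine sup_le le_sup_left (genFitting_le_iff.2 ⟨hF ▸ bot_le, fun Q hQ => ?_⟩)
  rcases le_fixedSubgroup_or_le_autEngelSubgroup hS α hQ.1 (hQ.isNonabelianSimple hF) with h | h
  · exact h.trans le_sup_right
  · exact h.trans le_sup_left

theorem autEngelSubgroup_eq_top_of_minimal_commutative (hα : autCommutator α = ⊤)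
    {M : Subgroup G} [IsMulCommutative M]
    (hM : Minimal (fun K : Subgroup G => K.Normal ∧ K.map α.toMonoidHom = K ∧ K ≠ ⊥) M)
    (hsup : autEngelSubgroup α n ⊔ M = ⊤) : autEngelSubgroup α n = ⊤ := by
  obtain ⟨hnormal, hinv, -⟩ := hM.prop
  have hmin (K : Subgroup G) (hK : K.Normal) (hKα : K.map α.toMonoidHom = K) (hle : K ≤ M) :
      K = ⊥ ∨ K = M :=
    or_iff_not_imp_left.2 fun hne => hM.eq_of_le ⟨hK, hKα, hne⟩ hle
  suffices hle : M ≤ autEngelSubgroup α n ∨ M ≤ fixedSubgroup α by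
    rcases hle with hle | hle
    · rwa [sup_eq_left.2 hle] at hsup
    · exact autEngelSubgroup_eq_top_of_sup_fixedSubgroup hα
        (top_le_iff.1 (hsup ▸ sup_le_sup_left hle _))
  have hinf : (autEngelSubgroup α n ⊓ M).map α.toMonoidHom = autEngelSubgroup α n ⊓ M := by
    rw [Subgroup.map_inf _ _ _ α.injective, map_autEngelSubgroup_self, hinv]
  rcases hmin _ (inf_normal_of_sup_eq_top hsup) hinf inf_le_right with hbot | heq
  · have hfixed : (M ⊓ fixedSubgroup α).Normal := ⟨fun x hx g => by
      rwa [Subgroup.mem_center_iff.1 (inf_fixedSubgroup_le_center hsup hbot hx) g,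
        mul_inv_cancel_right]⟩
    rcases hmin _ hfixed (map_eq_self_of_le_fixedSubgroup inf_le_right) inf_le_left with h | h
    · exact Or.inl (le_autEngelSubgroup_of_inf_fixedSubgroup_eq_bot hinv h n)
    · exact Or.inr (inf_eq_left.1 h)
  · exact Or.inl (inf_eq_right.1 heq)

theorem exists_minimal_commutative_of_fitting_ne_bot (α : MulAut G) (hF : fitting G ≠ ⊥) :
    ∃ M : Subgroup G, IsMulCommutative M ∧
      Minimal (fun K : Subgroup G => K.Normal ∧ K.map α.toMonoidHom = K ∧ K ≠ ⊥) M := by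
  let Z : Subgroup G := (Subgroup.center (fitting G)).map (fitting G).subtype
  have hfitting : (fitting G).map α.toMonoidHom = fitting G :=
    Subgroup.characteristic_iff_map_eq.1 isFittingFormation_isNilpotent.radical_characteristic α
  have hinv : Z.map α.toMonoidHom = Z := map_map_subtype_of_characteristic hfitting _
  have hne : Z ≠ ⊥ := by
    have := (Subgroup.nontrivial_iff_ne_bot _).2 hF
    have := isNilpotent_fitting (G := G)
    rw [Ne, Subgroup.map_eq_bot_iff_of_injective _ (fitting G).subtype_injective]
    exact Group.IsNilpotent.center_ne_bot _
  obtain ⟨M, hle, hM⟩ := (Set.toFinite {K : Subgroup G | K.Normal ∧ K.map α.toMonoidHom = K ∧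
    K ≠ ⊥}).exists_le_minimal ⟨ConjAct.normal_of_characteristic_of_normal, hinv, hne⟩
  have : IsMulCommutative Z := inferInstance
  refine ⟨M, Subgroup.le_centralizer_iff_isMulCommutative.1 ?_, hM⟩
  exact (hle.trans (Subgroup.le_centralizer Z)).trans (Subgroup.centralizer_le hle)

theorem autEngelSubgroup_eq_top (hS : EngelGeneratesSimpleProducts.{u} n)
    (hα : autCommutator α = ⊤) : autEngelSubgroup α n = ⊤ := by
  induction hc : Nat.card G using Nat.strong_induction_on generalizing G with
  | _ c ih =>
    rcases subsingleton_or_nontrivial G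
    · exact Subsingleton.elim _ _
    have hsup (M : Subgroup G) (_ : M.Normal) (hM : M.map α.toMonoidHom = M) (hne : M ≠ ⊥) :
        autEngelSubgroup α n ⊔ M = ⊤ :=
      autEngelSubgroup_sup_eq_top_of_quotient hM
        (ih _ (hc ▸ card_quotient_lt hne) (autCommutator_quotient_eq_top hα hM) rfl)
    by_cases hF : fitting G = ⊥
    · refine autEngelSubgroup_eq_top_of_fitting_eq_bot hS hα hF
        (hsup _ (genFitting_normal G) ?_ (genFitting_ne_bot G))
      rw [genFitting_eq_radical]
      exact Subgroup.characteristic_iff_map_eq.1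
        isFittingFormation_isQuasinilpotent.radical_characteristic α
    · obtain ⟨M, _, hM⟩ := exists_minimal_commutative_of_fitting_ne_bot α hF
      exact autEngelSubgroup_eq_top_of_minimal_commutative hα hM
        (hsup M hM.prop.1 hM.prop.2.1 hM.prop.2.2)

end Generation

/-! ### Iterated commutator subgroups -/

/-- `[K, α]`, the subgroup generated by all `[x, α]`, `x ∈ K`. -/
def commutatorWith {G : Type u} [Group G] (α : MulAut G) (K : Subgroup G) : Subgroup G :=
  Subgroup.closure ((fun x => x⁻¹ * α x) '' (K : Set G))

/-- `[G, α, …, α]` with `α` repeated `i` times, where each step takes the subgroup generated by the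
commutators; it contains the Engel subgroup `E_{G,i}(α)`. -/
def iterCommutator {G : Type u} [Group G] (α : MulAut G) (i : ℕ) : Subgroup G :=
  (commutatorWith α)^[i] ⊤

section IterCommutator

variable {G H : Type u} [Group G] [Group H] {α : MulAut G} {β : MulAut H} {K : Subgroup G}

theorem map_commutatorWith (f : G →* H) (hf : ∀ x, f (α x) = β (f x)) (K : Subgroup G) :
    (commutatorWith α K).map f = commutatorWith β (K.map f) := by
  simp only [commutatorWith, MonoidHom.map_closure, Set.image_image, Subgroup.coe_map, map_mul,
    map_inv, hf]

theorem commutatorWith_top (α : MulAut G) : commutatorWith α ⊤ = autCommutator α := by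
  rw [commutatorWith, Subgroup.coe_top, Set.image_univ, autCommutator]

theorem inv_mul_apply_mem_commutatorWith {x : G} (hx : x ∈ K) : x⁻¹ * α x ∈ commutatorWith α K :=
  Subgroup.subset_closure ⟨x, hx, rfl⟩

theorem le_normalizer_commutatorWith (α : MulAut G) (K : Subgroup G) :
    K ≤ Subgroup.normalizer (commutatorWith α K : Set G) := by
  refine Subgroup.le_normalizer_closure_iff.2 ?_
  rintro k hk _ ⟨x, hx, rfl⟩
  -- `k[x, α]k⁻¹ = [xk⁻¹, α][k⁻¹, α]⁻¹`
  have hmem := mul_mem (inv_mul_apply_mem_commutatorWith (α := α) (mul_mem hx (inv_mem hk)))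
    (inv_mem (inv_mul_apply_mem_commutatorWith (α := α) (inv_mem hk)))
  simpa [commutatorWith, mul_assoc] using hmem

theorem commutatorWith_le (hK : K.map α.toMonoidHom = K) : commutatorWith α K ≤ K := by
  refine (Subgroup.closure_le _).2 ?_
  rintro _ ⟨x, hx, rfl⟩
  exact mul_mem (inv_mem hx) (hK.le (Subgroup.mem_map_of_mem _ hx))

theorem iterCommutator_zero (α : MulAut G) : iterCommutator α 0 = ⊤ := rfl

theorem iterCommutator_succ (α : MulAut G) (i : ℕ) :
    iterCommutator α (i + 1) = commutatorWith α (iterCommutator α i) :=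
  Function.iterate_succ_apply' _ _ _

theorem map_iterCommutator (f : G →* H) (hs : Function.Surjective f)
    (hf : ∀ x, f (α x) = β (f x)) (i : ℕ) :
    (iterCommutator α i).map f = iterCommutator β i := by
  induction i with
  | zero => exact Subgroup.map_top_of_surjective f hs
  | succ i ih => rw [iterCommutator_succ, iterCommutator_succ, map_commutatorWith f hf, ih]

theorem map_iterCommutator_self (α : MulAut G) (i : ℕ) :
    (iterCommutator α i).map α.toMonoidHom = iterCommutator α i :=
  map_iterCommutator α.toMonoidHom α.surjective (fun _ => rfl) i

theorem iterCommutator_antitone (α : MulAut G) : Antitone (iterCommutator α) :=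
  antitone_nat_of_succ_le fun i =>
    iterCommutator_succ α i ▸ commutatorWith_le (map_iterCommutator_self α i)

theorem iterCommutator_le_normalizer_succ (α : MulAut G) (i : ℕ) :
    iterCommutator α i ≤ Subgroup.normalizer (iterCommutator α (i + 1) : Set G) :=
  iterCommutator_succ α i ▸ le_normalizer_commutatorWith α _

theorem isSubnormal_iterCommutator (α : MulAut G) (i : ℕ) : (iterCommutator α i).IsSubnormal := by
  induction i with
  | zero => exact Subgroup.IsSubnormal.top
  | succ i ih =>
    have hle := iterCommutator_antitone α i.le_succ
    exact .step _ _ hle ih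
      ((Subgroup.normal_subgroupOf_iff_le_normalizer hle).2 (iterCommutator_le_normalizer_succ α i))

theorem exists_iterCommutator_succ_eq [Finite G] (α : MulAut G) :
    ∃ m, iterCommutator α (m + 1) = iterCommutator α m := by
  obtain ⟨m, hm⟩ := WellFoundedLT.antitone_chain_condition (iterCommutator_antitone α)
  exact ⟨m, (hm (m + 1) m.le_succ).symm⟩

theorem autCommutator_restrictAut (hK : K.map α.toMonoidHom = K) (h : commutatorWith α K = K) :
    autCommutator (restrictAut α K hK) = ⊤ := by
  apply Subgroup.map_injective K.subtype_injective
  rw [← commutatorWith_top, map_commutatorWith (β := α) K.subtype (fun _ => rfl),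
    ← MonoidHom.range_eq_map, Subgroup.range_subtype, h]

theorem exists_iterCommutator_le_autEngelSubgroup [Finite G] {n : ℕ}
    (hS : EngelGeneratesSimpleProducts.{u} n) (α : MulAut G) :
    ∃ m, iterCommutator α m ≤ autEngelSubgroup α n := by
  obtain ⟨m, hm⟩ := exists_iterCommutator_succ_eq α
  rw [iterCommutator_succ] at hm
  exact ⟨m, le_autEngelSubgroup_of_restrictAut _
    (autEngelSubgroup_eq_top hS (autCommutator_restrictAut (map_iterCommutator_self α m) hm))⟩

end IterCommutator

/-! ### Engel subgroups of elements -/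

section Element

variable {G : Type u} [Group G]

theorem engelSubgroup_eq_autEngelSubgroup (g : G) (n : ℕ) :
    engelSubgroup g n = autEngelSubgroup (MulAut.conj g⁻¹) n := by
  have hcomm : (fun y : G => y⁻¹ * g⁻¹ * y * g) = fun y : G => y⁻¹ * MulAut.conj g⁻¹ y := by
    funext y
    simp [mul_assoc]
  unfold engelSubgroup autEngelSubgroup engelComm autEngelComm
  rw [hcomm]

theorem iterCommutator_le_normalizer_succ_sup_zpowers (g : G) (i : ℕ) :
    iterCommutator (MulAut.conj g⁻¹) i ≤ Subgroup.normalizer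
      (iterCommutator (MulAut.conj g⁻¹) (i + 1) ⊔ Subgroup.zpowers g : Subgroup G) := by
  set L := iterCommutator (MulAut.conj g⁻¹) (i + 1) ⊔ Subgroup.zpowers g
  refine Subgroup.le_normalizer_iff.2 fun k hk => ?_
  change L ≤ L.comap (MulAut.conj k).toMonoidHom
  refine sup_le (fun x hx => ?_) (Subgroup.zpowers_le.2 ?_)
  · exact (le_sup_left : _ ≤ L)
      (Subgroup.le_normalizer_iff.1 (iterCommutator_le_normalizer_succ _ i) k hk x hx)
  · -- `kgk⁻¹ = g[k⁻¹, g]⁻¹`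
    have hcomm := iterCommutator_succ (MulAut.conj g⁻¹) i ▸
      inv_mul_apply_mem_commutatorWith (α := MulAut.conj g⁻¹) (inv_mem hk)
    have hmem : _ ∈ L := mul_mem ((le_sup_right : _ ≤ L) (Subgroup.mem_zpowers g))
      (inv_mem ((le_sup_left : _ ≤ L) hcomm))
    simpa [mul_assoc] using hmem

theorem isSubnormal_iterCommutator_sup_zpowers (g : G) (i : ℕ) :
    (iterCommutator (MulAut.conj g⁻¹) i ⊔ Subgroup.zpowers g).IsSubnormal := by
  induction i with
  | zero =>
    rw [iterCommutator_zero, top_sup_eq]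
    exact Subgroup.IsSubnormal.top
  | succ i ih =>
    have hle := sup_le_sup_right (iterCommutator_antitone (MulAut.conj g⁻¹) i.le_succ)
      (Subgroup.zpowers g)
    exact .step _ _ hle ih ((Subgroup.normal_subgroupOf_iff_le_normalizer hle).2
      (sup_le (iterCommutator_le_normalizer_succ_sup_zpowers g i)
        (le_sup_right.trans Subgroup.le_normalizer)))

open scoped IsMulCommutative in
theorem mem_fitting_of_iterCommutator_eq_bot [Finite G] {g : G} {i : ℕ}
    (h : iterCommutator (MulAut.conj g⁻¹) i = ⊥) : g ∈ fitting G := by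
  have hsub := isSubnormal_iterCommutator_sup_zpowers g i
  rw [h, bot_sup_eq] at hsub
  exact le_fitting_of_isSubnormal hsub inferInstance (Subgroup.mem_zpowers g)

theorem mk_mem_fitting_of_engelSubgroup [Finite G] {n : ℕ}
    (hS : EngelGeneratesSimpleProducts.{u} n) {C : GroupClass.{u}} (hC : IsFittingFormation C)
    {g : G} (h : C (engelSubgroup g n)) : (g : G ⧸ radical C G) ∈ fitting (G ⧸ radical C G) := by
  obtain ⟨m, hm⟩ := exists_iterCommutator_le_autEngelSubgroup hS (MulAut.conj g⁻¹)
  rw [← engelSubgroup_eq_autEngelSubgroup] at hm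
  have hsub := isSubnormal_iterCommutator (MulAut.conj g⁻¹) m
  have hle : iterCommutator (MulAut.conj g⁻¹) m ≤ radical C G :=
    hC.le_radical_of_isSubnormal hsub (hC.of_mulEquiv (Subgroup.subgroupOfEquivOfLe hm)
      (hC.of_isSubnormal hsub.subgroupOf h))
  refine mem_fitting_of_iterCommutator_eq_bot (i := m) ?_
  rw [← map_iterCommutator (α := MulAut.conj g⁻¹) (QuotientGroup.mk' (radical C G))
    (QuotientGroup.mk'_surjective _) (fun x => by simp), Subgroup.map_eq_bot_iff,
    QuotientGroup.ker_mk']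
  exact hle

end Element

end EngelSink

theorem mainTheorem7 {G : Type u} [Group G] [Finite G] (n : ℕ) (hn : 0 < n)
    (hS : EngelGeneratesSimpleProducts.{u} n) :
    (∀ (g : G) (k : ℕ),
      genFittingHeight (engelSubgroup g n) = k → g ∈ genFittingSeries G (k + 1)) ∧
    (∀ (g : G) (k : ℕ),
      nonsolubleLength (engelSubgroup g n) = k → g ∈ nonsolubleRadical G k) ∧
    (∀ α : MulAut G, autCommutator α = ⊤ → autEngelSubgroup α n = ⊤) := by
  refine ⟨?_, ?_, fun α hα => autEngelSubgroup_eq_top hS hα⟩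
  · rintro g _ rfl
    have hC := isFittingFormation_iterExtension (fun _ => isFittingFormation_isQuasinilpotent.{u})
      (genFittingHeight (engelSubgroup g n))
    have hg := mk_mem_fitting_of_engelSubgroup hS hC (iterExtension_genFittingHeight _)
    rw [genFittingSeries_eq_radical, iterExtension,
      hC.radical_extensionClass isFittingFormation_isQuasinilpotent, ← genFitting_eq_radical]
    exact fitting_le_genFitting hg
  · rintro g k hk
    have hg := mk_mem_fitting_of_engelSubgroup hS (isFittingFormation_nonsolubleClass k)
      ((nonsolubleLength_le_iff _ k).1 hk.le)
    rw [fitting_quotient_radical_nonsolubleClass, Subgroup.mem_bot, QuotientGroup.eq_one_iff] at hg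
    rwa [nonsolubleRadical_eq_radical]
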